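/- A (finite) planar space $f=(\mathcal P,\mathcal L,\mathcal H)$ consists of a finite set $\mathcal P$ of points and sets $\mathcal L,\mathcal H\subseteq 2^{\mathcal P}$ of lines and planes such that every line has at least two points, any two distinct points lie on exactly one line, and any three distinct non-collinear points lie on exactly one plane. A set $S\subseteq\mathcal P$ is called collinear if it has at most one point or is contained in a line $L\in\mathcal L$; it is called coplanar if it is collinear or contained in a plane $H\in\mathcal H$. A strong realization of $f$ in $\mathbb P^3(\mathbb F_q)$ is an injective map $\sigma:\mathcal P\to\mathbb P^3(\mathbb F_q)$ such that for every $S\subseteq\mathcal P$, $\sigma(S)$ is contained in a line of $\mathbb P^3(\mathbb F_q)$ if and only if $S$ is collinear, and $\sigma(S)$ is contained in a plane of $\mathbb P^3(\mathbb F_q)$ if and only if $S$ is coplanar. Let $A_f(4,q)$ be the number of strong realizations of $f$ in $\mathbb P^3(\mathbb F_q)$. Two planar spaces are isomorphic if there is a bijection between their point sets that preserves collinearity and coplanarity of sets in both directions. A full line is a line with at least three points; a full plane is a plane with at least four points, not all collinear. A point has index $(i,j)$ if it lies on exactly $i$ full planes and exactly $j$ full lines. A hyperfiguration is a planar space with at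 least one point in which the index $(i,j)$ of every point satisfies $i\ge 4$, or $j\ge 3$, or $(i,j)=(3,0)$. Statement. For every planar space $f$ on $n$ points there exist polynomials $r(q)$ and $r_h(q)$ in $\mathbb Z[q]$, one $r_h$ for each isomorphism class $h$ of hyperfigurations on at most $n$ points, such that for every prime power $q$ $$A_f(4,q)=r(q)+\sum_h r_h(q)\,A_h(4,q),$$ where the sum runs over all isomorphism classes $h$ of hyperfigurations on at most $n$ points. Moreover, there is an algorithm, the same for all $n$, $f$ and $h$, that produces these polynomials: there are computable functions, one of which takes a description of $f$ (the number of points and the lists of lines and planes) to the list of coefficients of $r$, and the other of which takes a description of $f$ and a description of any hyperfiguration in a class $h$ to the list of coefficients of $r_h$. -/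

import Mathlib

open Polynomial LinearAlgebra.Projectivization

universe u v w

/-- A planar space on the set of points `P`: a linear space `(P, lines)` together with a set of
planes such that any three distinct non-collinear points lie on a unique plane. -/
@[ext]
structure PlanarSpace (P : Type u) where
  lines : Set (Set P)
  planes : Set (Set P)
  existsUnique_line : ∀ a b : P, a ≠ b → ∃! L : Set P, L ∈ lines ∧ a ∈ L ∧ b ∈ L
  nontrivial_of_line : ∀ L ∈ lines, ∃ a ∈ L, ∃ b ∈ L, a ≠ b
  existsUnique_plane : ∀ a b c : P, a ≠ b → a ≠ c → b ≠ c →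
    (¬ ∃ L ∈ lines, a ∈ L ∧ b ∈ L ∧ c ∈ L) →
    ∃! H : Set P, H ∈ planes ∧ a ∈ H ∧ b ∈ H ∧ c ∈ H

namespace PlanarSpace

variable {P : Type u} {Q : Type v}

/-- A set of points is collinear if it lies on a line of the space (a set with at most one point
is always collinear, even if the space has no lines). -/
def Collinear (f : PlanarSpace P) (S : Set P) : Prop :=
  S.Subsingleton ∨ ∃ L ∈ f.lines, S ⊆ L

/-- A set of points is coplanar if it lies on a plane of the space; collinear sets are always
coplanar. -/
def Coplanar (f : PlanarSpace P) (S : Set P) : Prop :=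
  f.Collinear S ∨ ∃ H ∈ f.planes, S ⊆ H

/-- Full lines: lines with at least three points. -/
def IsFullLine (f : PlanarSpace P) (L : Set P) : Prop :=
  L ∈ f.lines ∧ 3 ≤ L.encard

/-- Full planes: planes with at least four points. A member of `planes` all of whose points are on
one line is not determined by a non-collinear triple, carries no information, and is not counted. -/
def IsFullPlane (f : PlanarSpace P) (H : Set P) : Prop :=
  H ∈ f.planes ∧ 4 ≤ H.encard ∧ ¬ f.Collinear H

/-- The number of full planes through `p`: the first entry of the index of `p`. -/
noncomputable def planeIndex (f : PlanarSpace P) (p : P) : ℕ :=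
  {H : Set P | f.IsFullPlane H ∧ p ∈ H}.ncard

/-- The number of full lines through `p`: the second entry of the index of `p`. -/
noncomputable def lineIndex (f : PlanarSpace P) (p : P) : ℕ :=
  {L : Set P | f.IsFullLine L ∧ p ∈ L}.ncard

/-- Hyperfigurations: nonempty planar spaces in which the index `(i, j)` of every point satisfies
`i ≥ 4`, or `j ≥ 3`, or `(i, j) = (3, 0)`. -/
def IsHyperfiguration (f : PlanarSpace P) : Prop :=
  Nonempty P ∧ ∀ p : P, 4 ≤ f.planeIndex p ∨ 3 ≤ f.lineIndex p ∨
    (f.planeIndex p = 3 ∧ f.lineIndex p = 0)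

/-- Isomorphism of planar spaces: a bijection of the points that preserves lines and planes. -/
def Iso (f : PlanarSpace P) (g : PlanarSpace Q) : Prop :=
  ∃ e : P ≃ Q, (∀ S : Set P, g.Collinear (e '' S) ↔ f.Collinear S) ∧
    ∀ S : Set P, g.Coplanar (e '' S) ↔ f.Coplanar S

theorem Iso.refl (f : PlanarSpace P) : f.Iso f :=
  ⟨Equiv.refl P, by simp, by simp⟩

theorem Iso.symm {f : PlanarSpace P} {g : PlanarSpace Q} (h : f.Iso g) : g.Iso f := by
  obtain ⟨e, h1, h2⟩ := h
  refine ⟨e.symm, fun S => ?_, fun S => ?_⟩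
  · rw [← h1, Equiv.image_symm_image]
  · rw [← h2, Equiv.image_symm_image]

theorem Iso.trans {R : Type w} {f : PlanarSpace P} {g : PlanarSpace Q} {k : PlanarSpace R}
    (h : f.Iso g) (h' : g.Iso k) : f.Iso k := by
  obtain ⟨e, h1, h2⟩ := h
  obtain ⟨e', h1', h2'⟩ := h'
  refine ⟨e.trans e', fun S => ?_, fun S => ?_⟩
  · rw [← h1, ← h1', Equiv.coe_trans, Set.image_comp]
  · rw [← h2, ← h2', Equiv.coe_trans, Set.image_comp]

end PlanarSpace

/-- Three-dimensional projective space over `K`. -/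
abbrev ProjSpace3 (K : Type v) [Field K] : Type v := ℙ K (Fin 4 → K)

/-- A set of points of projective 3-space is contained in a line, that is, in the projectivization
of a 2-dimensional subspace of `K ^ 4`. -/
def InProjLine {K : Type v} [Field K] (T : Set (ProjSpace3 K)) : Prop :=
  ∃ W : Submodule K (Fin 4 → K), Module.finrank K W = 2 ∧ ∀ x ∈ T, x.submodule ≤ W

/-- A set of points of projective 3-space is contained in a plane, that is, in the projectivization
of a 3-dimensional subspace of `K ^ 4`. -/
def InProjPlane {K : Type v} [Field K] (T : Set (ProjSpace3 K)) : Prop :=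
  ∃ W : Submodule K (Fin 4 → K), Module.finrank K W = 3 ∧ ∀ x ∈ T, x.submodule ≤ W

namespace PlanarSpace

variable {P : Type u} {Q : Type w}

/-- Strong realizations of `f` in projective 3-space over `K`: injective maps which preserve lines
and planes in both directions. -/
structure StrongRealization (f : PlanarSpace P) (K : Type v) [Field K] where
  toFun : P → ProjSpace3 K
  injective : Function.Injective toFun
  line_iff : ∀ S : Set P, InProjLine (toFun '' S) ↔ f.Collinear S
  plane_iff : ∀ S : Set P, InProjPlane (toFun '' S) ↔ f.Coplanar S

/-- `A_f(4, q)`, where `q` is the order of `K`: the number of strong realizations of `f`. -/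
noncomputable def numRealizations (f : PlanarSpace P) (K : Type v) [Field K] : ℕ :=
  Nat.card (f.StrongRealization K)

theorem StrongRealization.ext_toFun {f : PlanarSpace P} {K : Type v} [Field K]
    {s t : f.StrongRealization K} (h : s.toFun = t.toFun) : s = t := by
  cases s; cases t; cases h; rfl

/-- Isomorphic planar spaces have the same number of strong realizations. -/
theorem Iso.numRealizations_eq {f : PlanarSpace P} {g : PlanarSpace Q} (h : f.Iso g)
    (K : Type v) [Field K] : f.numRealizations K = g.numRealizations K := by
  obtain ⟨e, h1, h2⟩ := h
  refine Nat.card_congr ⟨fun s => ⟨s.toFun ∘ e.symm, s.injective.comp e.symm.injective, ?_, ?_⟩,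
    fun s => ⟨s.toFun ∘ e, s.injective.comp e.injective, ?_, ?_⟩, ?_, ?_⟩
  · intro S
    rw [Set.image_comp, s.line_iff, ← h1, Equiv.image_symm_image]
  · intro S
    rw [Set.image_comp, s.plane_iff, ← h2, Equiv.image_symm_image]
  · intro S
    rw [Set.image_comp, s.line_iff, h1]
  · intro S
    rw [Set.image_comp, s.plane_iff, h2]
  · intro s
    apply StrongRealization.ext_toFun
    funext p
    simp
  · intro s
    apply StrongRealization.ext_toFun
    funext p
    simp

instance instFinite [Finite P] : Finite (PlanarSpace P) :=
  Finite.of_injective (fun f : PlanarSpace P => (f.lines, f.planes)) (by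
    intro f g h
    have h' := Prod.mk.inj h
    exact PlanarSpace.ext h'.1 h'.2)

end PlanarSpace

/-- The hyperfigurations on at most `n` points, on the point sets `{0, …, m - 1}` with `m ≤ n`. -/
structure Hyperfiguration (n : ℕ) where
  size : Fin (n + 1)
  space : PlanarSpace (Fin size)
  isHyperfiguration : space.IsHyperfiguration

namespace Hyperfiguration

instance instFinite (n : ℕ) : Finite (Hyperfiguration n) :=
  Finite.of_injective
    (fun h : Hyperfiguration n => (⟨h.size, h.space⟩ : Σ m : Fin (n + 1), PlanarSpace (Fin m))) (by
    intro h k hk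
    cases h; cases k
    simp only [Sigma.mk.injEq] at hk
    obtain ⟨h1, h2⟩ := hk
    subst h1
    cases h2
    rfl)

/-- Isomorphism as an equivalence relation on the hyperfigurations on at most `n` points. -/
instance isoSetoid (n : ℕ) : Setoid (Hyperfiguration n) where
  r h k := h.space.Iso k.space
  iseqv := ⟨fun h => .refl h.space, fun h => h.symm, fun h k => h.trans k⟩

end Hyperfiguration

/-- The isomorphism classes of hyperfigurations on at most `n` points. -/
abbrev HyperfigurationClass (n : ℕ) : Type := Quotient (Hyperfiguration.isoSetoid n)

namespace HyperfigurationClass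

noncomputable instance instFintype (n : ℕ) : Fintype (HyperfigurationClass n) :=
  Fintype.ofFinite _

/-- `A_h(4, q)` for an isomorphism class `h`. -/
noncomputable def numRealizations {n : ℕ} (h : HyperfigurationClass n) (K : Type v) [Field K] : ℕ :=
  Quotient.lift (fun k : Hyperfiguration n => k.space.numRealizations K)
    (fun _ _ hk => PlanarSpace.Iso.numRealizations_eq hk K) h

end HyperfigurationClass

/-- Finite descriptions of planar spaces, as inputs of algorithms: the number `n` of points, the
list of the lines and the list of the planes, each given as a list of labels of points; the points
are labelled by `0, …, n - 1`. -/
abbrev PlanarCode : Type := ℕ × List (List ℕ) × List (List ℕ)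

/-- `c` describes `f`, for some labelling `e` of the points. -/
def PlanarCode.Describes {P : Type u} (c : PlanarCode) (f : PlanarSpace P) : Prop :=
  ∃ e : P ≃ Fin c.1,
    f.lines = {L | ∃ l ∈ c.2.1, L = {p | (e p : ℕ) ∈ l}} ∧
    f.planes = {H | ∃ l ∈ c.2.2, H = {p | (e p : ℕ) ∈ l}}

theorem PlanarCode.exists_list_of_sets {P : Type u} {n : ℕ} (e : P ≃ Fin n) (T : Set (Set P)) :
    ∃ ls : List (List ℕ), T = {L | ∃ l ∈ ls, L = {p | (e p : ℕ) ∈ l}} := by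
  classical
  have : Finite P := Finite.of_equiv _ e.symm
  let toList : Set P → List ℕ := fun S => ((Set.toFinite S).toFinset.image fun p => (e p : ℕ)).toList
  have key : ∀ S : Set P, S = {p | (e p : ℕ) ∈ toList S} := by
    intro S
    ext p
    simp only [toList, Set.mem_ofPred_eq, Finset.mem_toList, Finset.mem_image,
      Set.Finite.mem_toFinset]
    constructor
    · intro h
      exact ⟨p, h, rfl⟩
    · rintro ⟨p', h, h'⟩
      rwa [← e.injective (Fin.ext h')]
  refine ⟨(Set.toFinite T).toFinset.toList.map toList, ?_⟩
  ext L
  simp only [List.mem_map, Finset.mem_toList, Set.Finite.mem_toFinset, Set.mem_ofPred_eq,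
    exists_exists_and_eq_and]
  constructor
  · intro h
    exact ⟨L, h, key L⟩
  · rintro ⟨L', h, h'⟩
    rwa [h', ← key L']

/-- Every finite planar space has a description. -/
theorem PlanarCode.exists_describes {P : Type u} [Finite P] (f : PlanarSpace P) :
    ∃ c : PlanarCode, c.Describes f := by
  obtain ⟨ls, h1⟩ := PlanarCode.exists_list_of_sets (Finite.equivFin P) f.lines
  obtain ⟨hs, h2⟩ := PlanarCode.exists_list_of_sets (Finite.equivFin P) f.planes
  exact ⟨(Nat.card P, ls, hs), Finite.equivFin P, h1, h2⟩

/-- The polynomial with the given list of coefficients, constant coefficient first. -/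
noncomputable def polyOfCoeffs (l : List ℤ) : ℤ[X] :=
  l.foldr (fun a p => C a + X * p) 0

/-!
Coplanarity and collinearity of points in `ℙ³` can be read off from the linearly independent sets of
points, so that realizations may be counted by combinatorial type. If the subspaces spanned by other
points which contain the point `p` have at most two minimal members, then the positions of `p` in
their intersection are the points of a subspace whose dimension `d` depends only on the type; there
are `1 + q + ⋯ + q ^ (d - 1)` of them. Hence the number of realizations of the type is this
polynomial times the number of realizations of the type without `p`, minus the numbers of
realizations of the types in which `p` is in a more special position. These types have fewer points
or fewer independent sets, so the expansion terminates. A type without such a point `p` either is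
empty, or has no realizations, or is the type of a hyperfiguration: if the index of a point in `ℙ³`
does not satisfy the condition on hyperfigurations, then so few full lines and full planes pass
through it that its constraints have at most two minimal members.
-/

section PointFamilies

variable {α : Type u} {β : Type w} {K : Type v} [Field K] {E : Type*} [AddCommGroup E] [Module K E]
  {σ ρ : α → ℙ K E} {A B : Set α} {W : Submodule K E}

/-- Linear independence of the points of a projective space that carry the labels in `A`, for a
family `σ` of labelled points. -/
def PointsIndep (σ : α → ℙ K E) (A : Set α) : Prop := LinearIndepOn K (fun x => (σ x).rep) A

/-- The linear span of the points that carry the labels in `A`, as a subspace of the vector space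
below the projective space. -/
def pointSpan (σ : α → ℙ K E) (A : Set α) : Submodule K E :=
  Submodule.span K ((fun x => (σ x).rep) '' A)

theorem submodule_le_iff_rep_mem (x : ℙ K E) : x.submodule ≤ W ↔ x.rep ∈ W := by
  rw [Projectivization.submodule_eq, Submodule.span_singleton_le_iff_mem]

theorem PointsIndep.mono (h : PointsIndep σ B) (hAB : A ⊆ B) : PointsIndep σ A :=
  LinearIndepOn.mono h hAB

theorem pointsIndep_empty (σ : α → ℙ K E) : PointsIndep σ ∅ := linearIndepOn_empty _ _

theorem pointsIndep_insert {a : α} (ha : a ∉ A) :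
    PointsIndep σ (insert a A) ↔ PointsIndep σ A ∧ (σ a).rep ∉ pointSpan σ A :=
  linearIndepOn_insert ha

theorem pointsIndep_congr (h : ∀ x ∈ A, σ x = ρ x) : PointsIndep σ A ↔ PointsIndep ρ A :=
  linearIndepOn_congr fun x hx => by simp only [h x hx]

theorem pointsIndep_image {φ : β → α} (hφ : Function.Injective φ) (A : Set β) :
    PointsIndep σ (φ '' A) ↔ PointsIndep (σ ∘ φ) A :=
  (linearIndependent_equiv (Equiv.Set.image φ A hφ)
    (f := fun x : (φ '' A : Set α) => (σ x).rep)).symm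

theorem pointsIndep_pair_iff {a b : α} (h : a ≠ b) : PointsIndep σ {a, b} ↔ σ a ≠ σ b := by
  rw [← Projectivization.linearIndependent_pair_iff_ne, PointsIndep, LinearIndepOn.pair_iff _ h,
    LinearIndependent.pair_iff]

theorem pointSpan_congr (h : ∀ x ∈ A, σ x = ρ x) : pointSpan σ A = pointSpan ρ A := by
  rw [pointSpan, pointSpan, Set.image_congr fun x hx => congrArg Projectivization.rep (h x hx)]

theorem pointSpan_image (φ : β → α) (A : Set β) :
    pointSpan σ (φ '' A) = pointSpan (σ ∘ φ) A := by
  rw [pointSpan, Set.image_image]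
  rfl

theorem pointSpan_mono (σ : α → ℙ K E) (h : A ⊆ B) : pointSpan σ A ≤ pointSpan σ B :=
  Submodule.span_mono (Set.image_mono h)

theorem rep_mem_pointSpan (σ : α → ℙ K E) {a : α} (h : a ∈ A) : (σ a).rep ∈ pointSpan σ A :=
  Submodule.subset_span ⟨a, h, rfl⟩

theorem pointSpan_le_iff : pointSpan σ A ≤ W ↔ ∀ a ∈ A, (σ a).rep ∈ W := by
  simp only [pointSpan, Submodule.span_le, Set.image_subset_iff]
  rfl

theorem pointSpan_union (σ : α → ℙ K E) (A B : Set α) :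
    pointSpan σ (A ∪ B) = pointSpan σ A ⊔ pointSpan σ B := by
  rw [pointSpan, Set.image_union, Submodule.span_union]
  rfl

theorem exists_pointsIndep_subset (σ : α → ℙ K E) (A : Set α) :
    ∃ I ⊆ A, PointsIndep σ I ∧ pointSpan σ I = pointSpan σ A := by
  obtain ⟨I, hIA, -, hA, hI⟩ := exists_linearIndepOn_extension
    (linearIndepOn_empty K fun x => (σ x).rep) (Set.empty_subset A)
  exact ⟨I, hIA, hI, (pointSpan_mono σ hIA).antisymm
    (pointSpan_le_iff.2 fun a ha => hA ⟨a, ha, rfl⟩)⟩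

section FiniteDimensional

variable [FiniteDimensional K E]

theorem PointsIndep.encard_eq_finrank (h : PointsIndep σ A) :
    A.encard = Module.finrank K (pointSpan σ A) := by
  have hA : LinearIndependent K fun x : A => (σ x).rep := h
  have := hA.finite
  have := Fintype.ofFinite A
  rw [pointSpan, Set.image_eq_range, finrank_span_eq_card hA, Set.encard,
    ENat.card_eq_coe_fintype_card]

theorem PointsIndep.card_eq_finrank {A : Finset α} (h : PointsIndep σ (A : Set α)) :
    A.card = Module.finrank K (pointSpan σ (A : Set α)) := by
  exact_mod_cast (Set.encard_coe_eq_coe_finsetCard A).symm.trans h.encard_eq_finrank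

theorem finrank_pointSpan_le_iff {k : ℕ} : Module.finrank K (pointSpan σ A) ≤ k ↔
    ∀ T ⊆ A, T.encard = (k + 1 : ℕ) → ¬ PointsIndep σ T := by
  constructor
  · intro h T hT hcard hindep
    rw [hindep.encard_eq_finrank, Nat.cast_inj] at hcard
    have := Submodule.finrank_mono (pointSpan_mono σ hT)
    omega
  · intro h
    by_contra! hk
    obtain ⟨I, hIA, hI, hspan⟩ := exists_pointsIndep_subset σ A
    have hcard := hI.encard_eq_finrank
    rw [hspan] at hcard
    obtain ⟨T, hTI, hT⟩ := Set.exists_subset_encard_eq (s := I) (k := ((k + 1 : ℕ) : ℕ∞))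
      (by rw [hcard]; exact_mod_cast hk)
    exact h T (hTI.trans hIA) hT (hI.mono hTI)

theorem pointsIndep_iff_of_encard_eq {k : ℕ} (hA : A.encard = (k + 1 : ℕ)) :
    PointsIndep σ A ↔ ¬ Module.finrank K (pointSpan σ A) ≤ k := by
  constructor
  · exact fun h hk => finrank_pointSpan_le_iff.1 hk A subset_rfl hA h
  · rw [finrank_pointSpan_le_iff]
    push Not
    rintro ⟨T, hTA, hT, h⟩
    rwa [← ((Set.finite_of_encard_eq_coe hA).subset hTA).eq_of_subset_of_encard_le hTA
      (by rw [hA, hT])]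

theorem exists_le_finrank_eq {k : ℕ} (h : Module.finrank K W ≤ k) (hk : k ≤ Module.finrank K E) :
    ∃ U : Submodule K E, W ≤ U ∧ Module.finrank K U = k := by
  induction k, h using Nat.le_induction with
  | base => exact ⟨W, le_rfl, rfl⟩
  | succ k _ ih =>
    obtain ⟨U, hWU, rfl⟩ := ih (by omega)
    have hU : U ≠ ⊤ := by
      rintro rfl
      rw [finrank_top] at hk
      omega
    obtain ⟨x, -, hx⟩ := SetLike.exists_of_lt hU.lt_top
    exact ⟨U ⊔ K ∙ x, hWU.trans le_sup_left, Submodule.finrank_sup_span_singleton hx⟩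

theorem exists_finrank_eq_forall_submodule_le_iff {k : ℕ} (hk : k ≤ Module.finrank K E) :
    (∃ W : Submodule K E, Module.finrank K W = k ∧ ∀ x ∈ σ '' A, x.submodule ≤ W) ↔
      Module.finrank K (pointSpan σ A) ≤ k := by
  simp only [Set.forall_mem_image, submodule_le_iff_rep_mem]
  constructor
  · rintro ⟨W, rfl, hW⟩
    exact Submodule.finrank_mono (pointSpan_le_iff.2 fun a ha => hW ha)
  · intro h
    obtain ⟨W, hW, hWk⟩ := exists_le_finrank_eq h hk
    exact ⟨W, hWk, fun a ha => hW (rep_mem_pointSpan σ ha)⟩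

end FiniteDimensional

theorem pointsIndep_of_encard_le_two (hσ : Function.Injective σ) (hA : A.encard ≤ 2) :
    PointsIndep σ A := by
  obtain hsub | hnontriv := A.subsingleton_or_nontrivial
  · obtain rfl | ⟨a, rfl⟩ := hsub.eq_empty_or_singleton
    · exact pointsIndep_empty σ
    · exact LinearIndepOn.singleton (σ a).rep_nonzero
  · obtain ⟨a, ha, b, hb, hab⟩ := hnontriv
    have hpair : ({a, b} : Set α) = A := Set.Finite.eq_of_subset_of_encard_le (Set.toFinite _)
      (Set.pair_subset ha hb) (by rwa [Set.encard_pair hab])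
    rw [← hpair, pointsIndep_pair_iff hab]
    exact hσ.ne hab

theorem ncard_rep_mem [Finite K] (W : Submodule K E) [FiniteDimensional K W] :
    {x : ℙ K E | x.rep ∈ W}.ncard = ∑ i ∈ Finset.range (Module.finrank K W), Nat.card K ^ i := by
  have hrange : {x : ℙ K E | x.rep ∈ W} =
      Set.range (Projectivization.map W.subtype W.injective_subtype) := by
    ext x
    constructor
    · intro hx
      refine ⟨.mk K ⟨x.rep, hx⟩ fun h => x.rep_nonzero (congrArg Subtype.val h), ?_⟩
      exact x.mk_rep
    · rintro ⟨y, rfl⟩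
      induction y using Projectivization.ind with
      | h w hw =>
        rw [Projectivization.map_mk, Set.mem_ofPred_eq, ← submodule_le_iff_rep_mem,
          Projectivization.submodule_mk, Submodule.span_singleton_le_iff_mem]
        exact w.2
  rw [hrange, ← Set.image_univ, Set.ncard_image_of_injective _
    (Projectivization.map_injective W.subtype W.injective_subtype), Set.ncard_univ,
    Projectivization.card_of_finrank K W rfl]

end PointFamilies

theorem ncard_eq_sum_ncard_fiber {S : Type u} {T : Type v} {X : Set S} (hX : X.Finite)
    (f : S → T) (t : Finset T) (h : ∀ x ∈ X, f x ∈ t) :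
    X.ncard = ∑ b ∈ t, {a | a ∈ X ∧ f a = b}.ncard := by
  classical
  rw [Set.ncard_eq_toFinset_card X hX,
    Finset.card_eq_sum_card_fiberwise fun x hx => h x (hX.mem_toFinset.1 hx)]
  refine Finset.sum_congr rfl fun b _ => ?_
  rw [← Set.ncard_coe_finset, Finset.coe_filter]
  simp only [hX.mem_toFinset]

theorem finite_setOf_forall_notMem_eq {S : Type u} {T : Type v} [Finite T] (V : Finset S) (b : T) :
    {σ : S → T | ∀ x ∉ V, σ x = b}.Finite := by
  refine Set.Finite.of_injOn (f := fun σ (x : V) => σ x) (t := Set.univ) (fun _ _ => trivial) ?_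
    Set.finite_univ
  intro σ hσ ρ hρ h
  funext x
  by_cases hx : x ∈ V
  · exact congrFun h ⟨x, hx⟩
  · rw [hσ x hx, hρ x hx]

/-- A finite combinatorial type of labelled points of a projective space: the set of labels and the
family of sets of labels that are required to be independent. -/
@[ext]
structure ConfigType (α : Type u) where
  points : Finset α
  indep : Finset (Finset α)

namespace ConfigType

variable {α : Type u} [DecidableEq α]

instance : DecidableEq (ConfigType α) := fun _ _ => decidable_of_iff _ ConfigType.ext_iff.symm

/-- The independent sets which do not contain `p`. -/
def avoiding (C : ConfigType α) (p : α) : Finset (Finset α) := {S ∈ C.indep | p ∉ S}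

/-- The independent sets which contain `p`. -/
def containing (C : ConfigType α) (p : α) : Finset (Finset α) := {S ∈ C.indep | p ∈ S}

/-- The type of a configuration without its point `p`. -/
def erase (C : ConfigType α) (p : α) : ConfigType α := ⟨C.points.erase p, C.avoiding p⟩

/-- The degeneration in which, of the independent sets containing `p`, only those in `J` are
left. -/
def degenerate (C : ConfigType α) (p : α) (J : Finset (Finset α)) : ConfigType α :=
  ⟨C.points, C.avoiding p ∪ J⟩

/-- For an independent set `S`: the point `y` lies in the span of `S`. -/
def Spans (C : ConfigType α) (S : Finset α) (y : α) : Prop := y ∈ S ∨ insert y S ∉ C.indep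

/-- `p` lies in no span of an independent set of other points. -/
def IsFree (C : ConfigType α) (p : α) : Prop := ∀ S ∈ C.avoiding p, ¬C.Spans S p

/-- `p` lies in the spans of the independent sets `F` and `G`, every span of other points which
contains `p` contains one of these two, and `B` is a basis of their sum. -/
def IsMeet (C : ConfigType α) (p : α) (F G B : Finset α) : Prop :=
  (C.Spans F p ∧ C.Spans G p) ∧ (B ⊆ F ∪ G ∧ ∀ y ∈ F ∪ G, C.Spans B y) ∧
    ∀ S ∈ C.avoiding p, C.Spans S p → (∀ y ∈ F, C.Spans S y) ∨ ∀ y ∈ G, C.Spans S y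

/-- The possible positions of `p` relative to the other points in an `n`-dimensional vector space
form, up to smaller degenerations, a subspace of dimension `d` which can be read off the type. -/
def HasFreedom (C : ConfigType α) (n : ℕ) (p : α) (d : ℕ) : Prop :=
  (C.IsFree p ∧ d = n) ∨ ∃ F ∈ C.avoiding p, ∃ G ∈ C.avoiding p, ∃ B ∈ C.avoiding p,
    C.IsMeet p F G B ∧ d = F.card + G.card - B.card

theorem mem_avoiding {C : ConfigType α} {p : α} {S : Finset α} :
    S ∈ C.avoiding p ↔ S ∈ C.indep ∧ p ∉ S := Finset.mem_filter

theorem mem_containing {C : ConfigType α} {p : α} {S : Finset α} :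
    S ∈ C.containing p ↔ S ∈ C.indep ∧ p ∈ S := Finset.mem_filter

end ConfigType

section Realizations

variable {α : Type u} {K : Type v} [Field K] {E : Type w} [AddCommGroup E]
  [Module K E]

open Classical in
/-- The combinatorial type of the points with labels in `V`. -/
noncomputable def typeOf (V : Finset α) (σ : α → ℙ K E) : ConfigType α :=
  ⟨V, {S ∈ V.powerset | PointsIndep σ (S : Set α)}⟩

/-- The labelled families of points of type `C`. Every label outside `C` is sent to the base point
`b`, so that there are only finitely many families over a finite field. -/
def realizations (b : ℙ K E) (C : ConfigType α) : Set (α → ℙ K E) :=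
  {σ | (∀ x ∉ C.points, σ x = b) ∧ typeOf C.points σ = C}

variable {b : ℙ K E} {C : ConfigType α} {σ ρ : α → ℙ K E} {p : α} {S V : Finset α}

theorem mem_typeOf_indep : S ∈ (typeOf V σ).indep ↔ S ⊆ V ∧ PointsIndep σ (S : Set α) := by
  classical
  rw [typeOf, Finset.mem_filter, Finset.mem_powerset]

theorem typeOf_eq_mk_iff {I : Finset (Finset α)} :
    typeOf V σ = ⟨V, I⟩ ↔ ∀ S, S ∈ I ↔ S ⊆ V ∧ PointsIndep σ (S : Set α) := by
  simp only [← mem_typeOf_indep]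
  rw [← Finset.ext_iff, eq_comm, ConfigType.mk.injEq]
  exact ⟨fun h => h.2, fun h => ⟨rfl, h⟩⟩

theorem mem_realizations_iff : σ ∈ realizations b C ↔ (∀ x ∉ C.points, σ x = b) ∧
    ∀ S, S ∈ C.indep ↔ S ⊆ C.points ∧ PointsIndep σ (S : Set α) :=
  and_congr_right fun _ => typeOf_eq_mk_iff

theorem finite_realizations [Finite K] [FiniteDimensional K E] (b : ℙ K E) (C : ConfigType α) :
    (realizations b C).Finite :=
  have := Module.finite_of_finite K (M := E)
  (finite_setOf_forall_notMem_eq C.points b).subset fun _ h => h.1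

variable [DecidableEq α]

/-- The families of points in which the points other than `p` form a configuration of type
`C.erase p`, and `p` is allowed to degenerate. -/
def extensions (b : ℙ K E) (C : ConfigType α) (p : α) : Set (α → ℙ K E) :=
  {σ | (∀ x ∉ C.points, σ x = b) ∧ (typeOf C.points σ).avoiding p = C.avoiding p ∧
    (typeOf C.points σ).containing p ⊆ C.containing p}

theorem finite_extensions [Finite K] [FiniteDimensional K E] (b : ℙ K E) (C : ConfigType α)
    (p : α) : (extensions b C p).Finite :=
  have := Module.finite_of_finite K (M := E)
  (finite_setOf_forall_notMem_eq C.points b).subset fun _ h => h.1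

theorem mem_realizations_degenerate_iff {J : Finset (Finset α)} (hJ : J ⊆ C.containing p) :
    σ ∈ realizations b (C.degenerate p J) ↔
      σ ∈ extensions b C p ∧ (typeOf C.points σ).containing p = J := by
  have hmem : ∀ S ∈ J, p ∈ S := fun S hS => (ConfigType.mem_containing.1 (hJ hS)).2
  simp only [realizations, extensions, ConfigType.degenerate, Set.mem_ofPred_eq, and_assoc]
  refine and_congr_right fun _ => ?_
  constructor
  · intro h
    have hcontaining : (typeOf C.points σ).containing p = J := by
      ext S
      rw [h]
      have := hmem S
      simp only [ConfigType.containing, ConfigType.avoiding, Finset.mem_filter, Finset.mem_union]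
      tauto
    refine ⟨?_, hcontaining ▸ hJ, hcontaining⟩
    ext S
    rw [h]
    have := hmem S
    simp only [ConfigType.avoiding, Finset.mem_filter, Finset.mem_union]
    tauto
  · rintro ⟨havoiding, -, hcontaining⟩
    rw [typeOf_eq_mk_iff]
    intro S
    rw [← mem_typeOf_indep, ← havoiding, ← hcontaining, ConfigType.avoiding,
      ConfigType.containing, Finset.union_comm, Finset.filter_union_filter_not_eq]

theorem ncard_extensions_eq_sum [Finite K] [FiniteDimensional K E] (b : ℙ K E)
    (C : ConfigType α) (p : α) : (extensions b C p).ncard =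
      ∑ J ∈ (C.containing p).powerset, (realizations b (C.degenerate p J)).ncard := by
  rw [ncard_eq_sum_ncard_fiber (finite_extensions b C p)
    (fun σ => (typeOf C.points σ).containing p) (C.containing p).powerset
    fun σ hσ => Finset.mem_powerset.2 hσ.2.2]
  refine Finset.sum_congr rfl fun J hJ => congrArg _ (Set.ext fun σ => ?_)
  exact (mem_realizations_degenerate_iff (Finset.mem_powerset.1 hJ)).symm

theorem mem_realizations_erase_iff : ρ ∈ realizations b (C.erase p) ↔
    (∀ x ∉ C.points.erase p, ρ x = b) ∧ (typeOf C.points ρ).avoiding p = C.avoiding p := by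
  rw [mem_realizations_iff]
  refine and_congr_right fun _ => ?_
  simp only [Finset.ext_iff (s₁ := ConfigType.avoiding _ _), ConfigType.mem_avoiding,
    mem_typeOf_indep, ConfigType.erase, Finset.subset_erase]
  refine forall_congr' fun S => ?_
  tauto

theorem update_mem_realizations_erase (hσ : σ ∈ extensions b C p) :
    Function.update σ p b ∈ realizations b (C.erase p) := by
  rw [mem_realizations_erase_iff, ← hσ.2.1]
  constructor
  · intro x hx
    obtain rfl | hxp := eq_or_ne x p
    · exact Function.update_self ..
    · rw [Function.update_of_ne hxp]
      exact hσ.1 x fun hxC => hx (Finset.mem_erase.2 ⟨hxp, hxC⟩)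
  · ext S
    simp only [ConfigType.mem_avoiding, mem_typeOf_indep]
    refine and_congr_left fun hpS => and_congr_right fun _ => pointsIndep_congr fun x hx => ?_
    exact Function.update_of_ne (ne_of_mem_of_not_mem hx hpS) _ _

end Realizations

section Expansion

variable {α : Type u} [DecidableEq α] {K : Type v} [Field K] {E : Type w} [AddCommGroup E]
  [Module K E] {b : ℙ K E} {C : ConfigType α} {σ ρ : α → ℙ K E} {p y : α} {S T : Finset α}

theorem mem_avoiding_iff_of_typeOf (hρ : (typeOf C.points ρ).avoiding p = C.avoiding p) :
    S ∈ C.avoiding p ↔ (S ⊆ C.points ∧ PointsIndep ρ (S : Set α)) ∧ p ∉ S := by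
  rw [← hρ, ConfigType.mem_avoiding, mem_typeOf_indep]

theorem spans_iff_of_pointsIndep (hS : PointsIndep ρ (S : Set α))
    (hinsert : insert y S ∈ C.indep ↔ PointsIndep ρ ((insert y S : Finset α) : Set α)) :
    C.Spans S y ↔ (ρ y).rep ∈ pointSpan ρ (S : Set α) := by
  by_cases hyS : y ∈ S
  · exact ⟨fun _ => rep_mem_pointSpan ρ (Finset.mem_coe.2 hyS), fun _ => .inl hyS⟩
  · rw [ConfigType.Spans, or_iff_right hyS, hinsert, Finset.coe_insert,
      pointsIndep_insert (by simpa using hyS), and_iff_right hS, not_not]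

theorem spans_iff_of_mem_realizations (hρ : ρ ∈ realizations b C) (hS : S ∈ C.indep)
    (hy : y ∈ C.points) : C.Spans S y ↔ (ρ y).rep ∈ pointSpan ρ (S : Set α) := by
  rw [mem_realizations_iff] at hρ
  obtain ⟨hSC, hSindep⟩ := (hρ.2 S).1 hS
  exact spans_iff_of_pointsIndep hSindep
    ((hρ.2 _).trans (and_iff_right (Finset.insert_subset hy hSC)))

theorem spans_iff_rep_mem (hρ : (typeOf C.points ρ).avoiding p = C.avoiding p)
    (hS : S ∈ C.avoiding p) (hy : y ∈ C.points) (hyp : y ≠ p) :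
    C.Spans S y ↔ (ρ y).rep ∈ pointSpan ρ (S : Set α) := by
  obtain ⟨⟨hSC, hSindep⟩, hpS⟩ := (mem_avoiding_iff_of_typeOf hρ).1 hS
  have hp : p ∉ insert y S := by simp [hpS, hyp.symm]
  refine spans_iff_of_pointsIndep hSindep ?_
  rw [← and_iff_left (a := _ ∈ C.indep) hp, ← ConfigType.mem_avoiding,
    mem_avoiding_iff_of_typeOf hρ, and_iff_left hp, and_iff_right (Finset.insert_subset hy hSC)]

theorem forall_spans_iff_pointSpan_le (hρ : (typeOf C.points ρ).avoiding p = C.avoiding p)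
    (hS : S ∈ C.avoiding p) (hT : T ∈ C.avoiding p) :
    (∀ y ∈ T, C.Spans S y) ↔ pointSpan ρ (T : Set α) ≤ pointSpan ρ (S : Set α) := by
  obtain ⟨⟨hTC, -⟩, hpT⟩ := (mem_avoiding_iff_of_typeOf hρ).1 hT
  rw [pointSpan_le_iff]
  exact forall₂_congr fun y hy => spans_iff_rep_mem hρ hS (hTC hy) (ne_of_mem_of_not_mem hy hpT)

theorem pointsIndep_update_iff (x : ℙ K E) (hp : p ∉ S) :
    PointsIndep (Function.update ρ p x) (S : Set α) ↔ PointsIndep ρ (S : Set α) :=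
  pointsIndep_congr fun _ hy => Function.update_of_ne (ne_of_mem_of_not_mem hy hp) _ _

theorem pointsIndep_update_insert_iff (x : ℙ K E) (hp : p ∉ S) :
    PointsIndep (Function.update ρ p x) (insert p S : Finset α) ↔
      PointsIndep ρ (S : Set α) ∧ x.rep ∉ pointSpan ρ (S : Set α) := by
  rw [Finset.coe_insert, pointsIndep_insert (by simpa using hp), pointsIndep_update_iff x hp,
    Function.update_self, pointSpan_congr (ρ := ρ) fun _ hy =>
      Function.update_of_ne (ne_of_mem_of_not_mem hy (by simpa using hp)) _ _]

theorem update_mem_extensions_iff (hp : p ∈ C.points) (hρ : ρ ∈ realizations b (C.erase p))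
    (x : ℙ K E) : Function.update ρ p x ∈ extensions b C p ↔
      ∀ S ∈ C.avoiding p, C.Spans S p → x.rep ∈ pointSpan ρ (S : Set α) := by
  obtain ⟨hbase, htype⟩ := mem_realizations_erase_iff.1 hρ
  have hsupport : ∀ y ∉ C.points, Function.update ρ p x y = b := fun y hy => by
    rw [Function.update_of_ne (ne_of_mem_of_not_mem hp hy).symm]
    exact hbase y fun h => hy (Finset.mem_of_mem_erase h)
  have hrest : (typeOf C.points (Function.update ρ p x)).avoiding p = C.avoiding p := by
    ext S
    rw [mem_avoiding_iff_of_typeOf htype, ConfigType.mem_avoiding, mem_typeOf_indep]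
    exact and_congr_left fun hpS => and_congr_right fun _ => pointsIndep_update_iff x hpS
  simp only [extensions, Set.mem_ofPred_eq, hrest, true_and]
  rw [and_iff_right hsupport]
  constructor
  · intro h S hS hspans
    obtain ⟨⟨hSC, hSindep⟩, hpS⟩ := (mem_avoiding_iff_of_typeOf htype).1 hS
    by_contra hx
    refine hspans.elim hpS fun hdep => hdep (Finset.mem_filter.1 (h ?_)).1
    rw [ConfigType.mem_containing, mem_typeOf_indep, pointsIndep_update_insert_iff x hpS]
    exact ⟨⟨Finset.insert_subset hp hSC, hSindep, hx⟩, Finset.mem_insert_self p S⟩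
  · intro h T hT
    obtain ⟨hTindep, hpT⟩ := ConfigType.mem_containing.1 hT
    rw [← Finset.insert_erase hpT, mem_typeOf_indep, Finset.insert_subset_iff,
      pointsIndep_update_insert_iff x (Finset.notMem_erase p T)] at hTindep
    obtain ⟨⟨-, hTC⟩, hindep, hx⟩ := hTindep
    by_contra hnot
    refine hx (h _ ((mem_avoiding_iff_of_typeOf htype).2
      ⟨⟨hTC, hindep⟩, Finset.notMem_erase p T⟩) (.inr fun hmem => hnot ?_))
    rw [Finset.insert_erase hpT] at hmem
    exact ConfigType.mem_containing.2 ⟨hmem, hpT⟩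

theorem finrank_inf_of_isMeet [FiniteDimensional K E]
    (hρ : (typeOf C.points ρ).avoiding p = C.avoiding p) {F G B : Finset α}
    (hF : F ∈ C.avoiding p) (hG : G ∈ C.avoiding p) (hB : B ∈ C.avoiding p)
    (h : C.IsMeet p F G B) :
    Module.finrank K ↥(pointSpan ρ (F : Set α) ⊓ pointSpan ρ (G : Set α)) =
      F.card + G.card - B.card := by
  have hrank : ∀ S ∈ C.avoiding p, S.card = Module.finrank K (pointSpan ρ (S : Set α)) :=
    fun S hS => ((mem_avoiding_iff_of_typeOf hρ).1 hS).1.2.card_eq_finrank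
  have hsup : pointSpan ρ (F : Set α) ⊔ pointSpan ρ (G : Set α) = pointSpan ρ (B : Set α) := by
    obtain ⟨-, ⟨hBFG, hspans⟩, -⟩ := h
    refine le_antisymm (sup_le ?_ ?_) ?_
    · exact (forall_spans_iff_pointSpan_le hρ hB hF).1 fun y hy =>
        hspans y (Finset.mem_union_left G hy)
    · exact (forall_spans_iff_pointSpan_le hρ hB hG).1 fun y hy =>
        hspans y (Finset.mem_union_right F hy)
    · rw [← pointSpan_union]
      exact pointSpan_mono ρ (by exact_mod_cast hBFG)
  have := Submodule.finrank_sup_add_finrank_inf_eq (pointSpan ρ (F : Set α))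
    (pointSpan ρ (G : Set α))
  rw [hsup] at this
  rw [hrank F hF, hrank G hG, hrank B hB, ← this, Nat.add_sub_cancel_left]

theorem exists_submodule_of_hasFreedom [FiniteDimensional K E] {d : ℕ} (hp : p ∈ C.points)
    (h : C.HasFreedom (Module.finrank K E) p d) (hρ : ρ ∈ realizations b (C.erase p)) :
    ∃ W : Submodule K E, Module.finrank K W = d ∧
      ∀ x, Function.update ρ p x ∈ extensions b C p ↔ x.rep ∈ W := by
  have htype := (mem_realizations_erase_iff.1 hρ).2
  simp only [update_mem_extensions_iff hp hρ]
  obtain ⟨hfree, rfl⟩ | ⟨F, hF, G, hG, B, hB, hmeet, rfl⟩ := h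
  · exact ⟨⊤, finrank_top K E, fun x => ⟨fun _ => trivial, fun _ S hS hp => (hfree S hS hp).elim⟩⟩
  · refine ⟨_, finrank_inf_of_isMeet htype hF hG hB hmeet, fun x => ⟨fun h => ?_, ?_⟩⟩
    · exact ⟨h F hF hmeet.1.1, h G hG hmeet.1.2⟩
    · rintro ⟨hxF, hxG⟩ S hS hpS
      obtain hFS | hGS := hmeet.2.2 S hS hpS
      · exact (forall_spans_iff_pointSpan_le htype hS hF).1 hFS hxF
      · exact (forall_spans_iff_pointSpan_le htype hS hG).1 hGS hxG

theorem ncard_extensions_eq_mul [Finite K] [FiniteDimensional K E] {d : ℕ} (hp : p ∈ C.points)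
    (h : C.HasFreedom (Module.finrank K E) p d) : (extensions b C p).ncard =
      (∑ i ∈ Finset.range d, Nat.card K ^ i) * (realizations b (C.erase p)).ncard := by
  have hfin := finite_realizations b (C.erase p)
  rw [ncard_eq_sum_ncard_fiber (finite_extensions b C p) (fun σ => Function.update σ p b)
    hfin.toFinset fun σ hσ => hfin.mem_toFinset.2 (update_mem_realizations_erase hσ),
    Set.ncard_eq_toFinset_card _ hfin, mul_comm, ← smul_eq_mul, ← Finset.sum_const]
  refine Finset.sum_congr rfl fun ρ hρ => ?_
  rw [hfin.mem_toFinset] at hρ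
  obtain ⟨W, rfl, hW⟩ := exists_submodule_of_hasFreedom hp h hρ
  have hρp : ρ p = b := hρ.1 p (Finset.notMem_erase p C.points)
  rw [← ncard_rep_mem, ← Set.ncard_image_of_injective _ (Function.update_injective ρ p)]
  congr 1
  ext σ
  constructor
  · rintro ⟨hσ, rfl⟩
    exact ⟨σ p, (hW _).1 (by simpa using hσ), by simp⟩
  · rintro ⟨x, hx, rfl⟩
    exact ⟨(hW x).2 hx, by simp [← hρp]⟩

/-- In the sum over all degenerations the full set of independent sets containing `p` gives back
`C` itself. -/
theorem ncard_realizations_expand [Finite K] [FiniteDimensional K E] {d : ℕ} (b : ℙ K E)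
    (hp : p ∈ C.points) (h : C.HasFreedom (Module.finrank K E) p d) :
    (realizations b C).ncard +
        ∑ J ∈ (C.containing p).ssubsets, (realizations b (C.degenerate p J)).ncard =
      (∑ i ∈ Finset.range d, Nat.card K ^ i) * (realizations b (C.erase p)).ncard := by
  have hself : C.degenerate p (C.containing p) = C := by
    rw [ConfigType.degenerate, ConfigType.avoiding, ConfigType.containing, Finset.union_comm,
      Finset.filter_union_filter_not_eq]
  rw [← ncard_extensions_eq_mul hp h, ncard_extensions_eq_sum, Finset.ssubsets,
    ← Finset.add_sum_erase _ _ (Finset.mem_powerset_self (C.containing p)), hself]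

end Expansion

namespace ConfigType

variable {α : Type u} [DecidableEq α] (C : ConfigType α)

instance (S y) : Decidable (C.Spans S y) := by unfold Spans; infer_instance

instance (p) : Decidable (C.IsFree p) := by unfold IsFree; infer_instance

instance (p F G B) : Decidable (C.IsMeet p F G B) := by unfold IsMeet; infer_instance

end ConfigType

/-- The members of a list of lists, as finite sets. -/
def family {α : Type u} [DecidableEq α] (M : List (List α)) : Finset (Finset α) :=
  (M.map List.toFinset).toFinset

/-- Combinatorial types in the form in which they are handled by the algorithm: the list of the
labels and the list of the independent sets. -/
abbrev ConfigCode : Type := List ℕ × List (List ℕ)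

/-- A signed monomial times the number of realizations of a type: `(s, k, τ)` stands for
`± q ^ k * #τ`, with the negative sign if `s` is `true`. -/
abbrev ConfigTerm : Type := Bool × ℕ × ConfigCode

namespace ConfigCode

/-- The combinatorial type described by a code. -/
def toType (τ : ConfigCode) : ConfigType ℕ := ⟨τ.1.toFinset, family τ.2⟩

/-- A code is well-formed if it contains no repetitions. -/
structure WellFormed (τ : ConfigCode) : Prop where
  nodup_points : τ.1.Nodup
  nodup_of_mem : ∀ T ∈ τ.2, T.Nodup
  nodup_family : (τ.2.map List.toFinset).Nodup

/-- The independent sets which do not contain `p`, as a list. -/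
def avoiding (τ : ConfigCode) (p : ℕ) : List (List ℕ) := τ.2.filter fun S => ¬p ∈ S

/-- The independent sets which contain `p`, as a list. -/
def containing (τ : ConfigCode) (p : ℕ) : List (List ℕ) := τ.2.filter fun S => p ∈ S

/-- All triples of members of a list. -/
def triples (D : List (List ℕ)) : List (List ℕ × List ℕ × List ℕ) :=
  D.flatMap fun F => D.flatMap fun G => D.map fun B => (F, G, B)

/-- The points at which the number of realizations in an `n`-dimensional vector space can be
expanded, together with the dimensions of the subspaces formed by their positions. -/
def choices (n : ℕ) (τ : ConfigCode) : List (ℕ × ℕ) :=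
  τ.1.flatMap fun p => (if τ.toType.IsFree p then [(p, n)] else []) ++
    ((triples (τ.avoiding p)).filter fun F =>
      τ.toType.IsMeet p F.1.toFinset F.2.1.toFinset F.2.2.toFinset).map fun F =>
        (p, F.1.length + F.2.1.length - F.2.2.length)

/-- Removal of a point. -/
def remove (τ : ConfigCode) (p : ℕ) : ConfigCode := (τ.1.filter fun x => ¬x = p, τ.avoiding p)

/-- The proper degenerations of a type in which only independent sets containing `p` become
dependent. -/
def degenerations (τ : ConfigCode) (p : ℕ) : List ConfigCode :=
  ((τ.containing p).sublists'.filter fun N => ¬N = τ.containing p).map fun N =>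
    (τ.1, τ.avoiding p ++ N)

/-- The expansion at the point `c.1`, whose positions form a subspace of dimension `c.2`. -/
def expandAt (τ : ConfigCode) (c : ℕ × ℕ) : List ConfigTerm :=
  ((List.range c.2).map fun i => (false, i, τ.remove c.1)) ++
    (τ.degenerations c.1).map fun g => (true, 0, g)

/-- The expansion at the first point at which it is possible, if there is one. -/
def expand (n : ℕ) (τ : ConfigCode) : List ConfigTerm :=
  ((τ.choices n).head?.map fun c => τ.expandAt c).getD [(false, 0, τ)]

/-- The expansion of every term of a linear combination. -/
def step (n : ℕ) (ts : List ConfigTerm) : List ConfigTerm :=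
  ts.flatMap fun t => (expand n t.2.2).map fun u => (xor t.1 u.1, t.2.1 + u.2.1, u.2.2)

/-- A number which every expansion decreases. -/
def size (τ : ConfigCode) : ℕ := τ.1.length + τ.2.length

/-- The expansion into terms which cannot be expanded any further. -/
def run (n : ℕ) (τ : ConfigCode) : List ConfigTerm := (step n)^[τ.size] [(false, 0, τ)]

end ConfigCode

section Sublists

variable {β : Type u} {γ : Type v} [DecidableEq β] [DecidableEq γ] {R : Type w}

theorem sum_map_sublists'_toFinset [AddCommMonoid R] {l : List γ} (hl : l.Nodup)
    (f : Finset γ → R) :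
    (l.sublists'.map fun s => f s.toFinset).sum = ∑ J ∈ l.toFinset.powerset, f J := by
  induction l generalizing f with
  | nil => simp
  | cons a l ih =>
    obtain ⟨ha, hl⟩ := List.nodup_cons.1 hl
    simp only [List.sublists'_cons, List.map_append, List.sum_append, List.map_map,
      Function.comp_def, List.toFinset_cons]
    rw [Finset.sum_powerset_insert (by simpa using ha), ih hl,
      ih hl fun J => f (insert a J)]

theorem sum_map_proper_sublists'_toFinset [AddCommGroup R] {l : List β} {g : β → γ}
    (hl : (l.map g).Nodup) (f : Finset γ → R) :
    ((l.sublists'.filter fun s => ¬s = l).map fun s => f (s.map g).toFinset).sum =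
      ∑ J ∈ (l.map g).toFinset.ssubsets, f J := by
  have hnodup : l.sublists'.Nodup := List.nodup_sublists'.2 hl.of_map
  have hperm : l.sublists'.Perm (l :: l.sublists'.filter fun s => ¬s = l) := by
    refine (List.perm_ext_iff_of_nodup hnodup
      (List.nodup_cons.2 ⟨by simp, hnodup.filter _⟩)).2 fun s => ?_
    by_cases hs : s = l <;> simp [hs]
  have htotal := sum_map_sublists'_toFinset hl f
  rw [List.sublists'_map, List.map_map, (hperm.map _).sum_eq, List.map_cons, List.sum_cons,
    ← Finset.add_sum_erase _ _ (Finset.mem_powerset_self _)] at htotal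
  exact add_left_cancel htotal

end Sublists

namespace ConfigCode

variable {τ : ConfigCode} {p d n : ℕ}

theorem family_filter {M : List (List ℕ)} {q : List ℕ → Prop} {q' : Finset ℕ → Prop}
    [DecidablePred q] [DecidablePred q'] (h : ∀ S, q S ↔ q' S.toFinset) :
    family (M.filter fun S => q S) = {S ∈ family M | q' S} := by
  ext S
  simp only [family, List.mem_toFinset, List.mem_map, List.mem_filter, decide_eq_true_eq,
    Finset.mem_filter, h]
  constructor
  · rintro ⟨T, ⟨hT, hq⟩, rfl⟩
    exact ⟨⟨T, hT, rfl⟩, hq⟩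
  · rintro ⟨⟨T, hT, rfl⟩, hq⟩
    exact ⟨T, ⟨hT, hq⟩, rfl⟩

theorem family_avoiding (τ : ConfigCode) (p : ℕ) :
    family (τ.avoiding p) = τ.toType.avoiding p :=
  family_filter fun S => by rw [List.mem_toFinset]

theorem family_containing (τ : ConfigCode) (p : ℕ) :
    family (τ.containing p) = τ.toType.containing p :=
  family_filter fun S => by rw [List.mem_toFinset]

theorem toType_remove (τ : ConfigCode) (p : ℕ) : (τ.remove p).toType = τ.toType.erase p := by
  rw [ConfigType.erase, ← family_avoiding, toType, remove]
  congr
  ext x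
  simp [toType, and_comm]

theorem toType_degenerate (τ : ConfigCode) (p : ℕ) (N : List (List ℕ)) :
    toType (τ.1, τ.avoiding p ++ N) = τ.toType.degenerate p (family N) := by
  rw [ConfigType.degenerate, ← family_avoiding, toType]
  simp only [family, List.map_append, List.toFinset_append]
  rfl

theorem WellFormed.remove (h : τ.WellFormed) (p : ℕ) : (τ.remove p).WellFormed where
  nodup_points := h.nodup_points.filter _
  nodup_of_mem T hT := h.nodup_of_mem T (List.mem_of_mem_filter hT)
  nodup_family := h.nodup_family.sublist (List.filter_sublist.map _)

theorem append_subperm_of_sublist_containing {N : List (List ℕ)}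
    (hN : N.Sublist (τ.containing p)) : (τ.avoiding p ++ N).Subperm τ.2 := by
  refine ((List.Sublist.refl _).append hN).subperm.trans (List.Perm.subperm ?_)
  rw [avoiding, containing]
  simpa using List.perm_append_comm.trans
    (List.filter_append_perm (fun S : List ℕ => decide (p ∈ S)) τ.2)

theorem WellFormed.degenerate (h : τ.WellFormed) {N : List (List ℕ)}
    (hN : N.Sublist (τ.containing p)) : WellFormed (τ.1, τ.avoiding p ++ N) where
  nodup_points := h.nodup_points
  nodup_of_mem T hT := h.nodup_of_mem T ((append_subperm_of_sublist_containing hN).subset hT)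
  nodup_family := by
    obtain ⟨l, hperm, hl⟩ := append_subperm_of_sublist_containing hN
    exact (hperm.map _).nodup_iff.1 (h.nodup_family.sublist (hl.map _))

theorem exists_mem_avoiding_iff {Q : Finset ℕ → Prop} :
    (∃ T ∈ τ.avoiding p, Q T.toFinset) ↔ ∃ S ∈ τ.toType.avoiding p, Q S := by
  simp [← family_avoiding, family]

theorem mem_choices (h : τ.WellFormed) :
    (p, d) ∈ τ.choices n ↔ p ∈ τ.toType.points ∧ τ.toType.HasFreedom n p d := by
  have hcard : ∀ T ∈ τ.avoiding p, T.toFinset.card = T.length := fun T hT =>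
    List.toFinset_card_of_nodup (h.nodup_of_mem T (List.mem_of_mem_filter hT))
  have hmeet : (∃ F ∈ triples (τ.avoiding p), τ.toType.IsMeet p F.1.toFinset F.2.1.toFinset
      F.2.2.toFinset ∧ F.1.length + F.2.1.length - F.2.2.length = d) ↔
      ∃ F ∈ τ.toType.avoiding p, ∃ G ∈ τ.toType.avoiding p, ∃ B ∈ τ.toType.avoiding p,
        τ.toType.IsMeet p F G B ∧ d = F.card + G.card - B.card := by
    simp only [← exists_mem_avoiding_iff]
    simp only [triples, List.mem_flatMap, List.mem_map]
    constructor
    · rintro ⟨_, ⟨F, hF, G, hG, B, hB, rfl⟩, hm, rfl⟩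
      exact ⟨F, hF, G, hG, B, hB, hm, by rw [hcard F hF, hcard G hG, hcard B hB]⟩
    · rintro ⟨F, hF, G, hG, B, hB, hm, rfl⟩
      exact ⟨_, ⟨F, hF, G, hG, B, hB, rfl⟩, hm, by rw [hcard F hF, hcard G hG, hcard B hB]⟩
  rw [ConfigType.HasFreedom, ← hmeet]
  simp only [choices, List.mem_flatMap, List.mem_append, List.mem_map, List.mem_filter,
    decide_eq_true_eq, List.mem_ite_nil_right, List.mem_singleton, Prod.mk.injEq]
  constructor
  · rintro ⟨_, hp, ⟨hfree, rfl, rfl⟩ | ⟨F, ⟨hF, hm⟩, rfl, hd⟩⟩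
    · exact ⟨List.mem_toFinset.2 hp, .inl ⟨hfree, rfl⟩⟩
    · exact ⟨List.mem_toFinset.2 hp, .inr ⟨F, hF, hm, hd⟩⟩
  · rintro ⟨hp, ⟨hfree, rfl⟩ | ⟨F, hF, hm, hd⟩⟩
    · exact ⟨p, List.mem_toFinset.1 hp, .inl ⟨hfree, rfl, rfl⟩⟩
    · exact ⟨p, List.mem_toFinset.1 hp, .inr ⟨F, ⟨hF, hm⟩, rfl, hd⟩⟩

end ConfigCode

theorem coeff_polyOfCoeffs (l : List ℤ) (k : ℕ) :
    (polyOfCoeffs l).coeff k = l.getD k 0 := by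
  induction l generalizing k with
  | nil => simp [polyOfCoeffs]
  | cons a l ih =>
    rw [polyOfCoeffs, List.foldr_cons, ← polyOfCoeffs]
    cases k with
    | zero => simp
    | succ k => rw [coeff_add, coeff_C_succ, zero_add, coeff_X_mul, ih, List.getD_cons_succ]

namespace ConfigTerm

/-- The sum of the signed monomials of a list of terms, as a list of coefficients. The sum of all
exponents serves as a bound for the degree. -/
def coeffs (ts : List ConfigTerm) : List ℤ :=
  (List.range ((ts.map fun t => t.2.1).sum + 1)).map fun k =>
    Int.subNatNat (ts.filter fun t => t.1 = false ∧ t.2.1 = k).length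
      (ts.filter fun t => t.1 = true ∧ t.2.1 = k).length

/-- The signed monomial of a term. -/
noncomputable def monomial (t : ConfigTerm) : ℤ[X] := (if t.1 then -1 else 1) * X ^ t.2.1

theorem monomial_xor_add (t u : ConfigTerm) :
    monomial (xor t.1 u.1, t.2.1 + u.2.1, u.2.2) = t.monomial * u.monomial := by
  obtain ⟨a, i, τ⟩ := t
  obtain ⟨b, j, υ⟩ := u
  cases a <;> cases b <;> simp [monomial, pow_add]

theorem coeff_sum_map_monomial (ts : List ConfigTerm) (k : ℕ) : (ts.map monomial).sum.coeff k =
    Int.subNatNat (ts.filter fun t => t.1 = false ∧ t.2.1 = k).length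
      (ts.filter fun t => t.1 = true ∧ t.2.1 = k).length := by
  rw [Int.subNatNat_eq_coe]
  induction ts with
  | nil => simp
  | cons t ts ih =>
    rw [List.map_cons, List.sum_cons, coeff_add, ih]
    obtain ⟨a, i, τ⟩ := t
    obtain rfl | hi := eq_or_ne i k
    · cases a <;> simp [monomial] <;> ring
    · cases a <;> simp [monomial, coeff_X_pow, hi, hi.symm]

theorem polyOfCoeffs_coeffs (ts : List ConfigTerm) :
    polyOfCoeffs (coeffs ts) = (ts.map monomial).sum := by
  ext k
  rw [coeff_polyOfCoeffs, coeffs, coeff_sum_map_monomial]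
  by_cases hk : k < (ts.map fun t => t.2.1).sum + 1
  · rw [List.getD_eq_getElem _ _ (by simpa using hk)]
    simp
  · rw [List.getD_eq_default _ _ (by simpa using Nat.le_of_not_lt hk)]
    have hne : ∀ t ∈ ts, t.2.1 ≠ k := by
      rintro t ht rfl
      exact hk (Nat.lt_succ_of_le (List.single_le_sum (by simp) _ (List.mem_map_of_mem ht)))
    have hnil (s : Bool) : (ts.filter fun t => t.1 = s ∧ t.2.1 = k) = [] :=
      List.filter_eq_nil_iff.2 fun t ht => by simp [hne t ht]
    rw [hnil, hnil]
    rfl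

variable {K : Type v} [Field K] {E : Type w} [AddCommGroup E] [Module K E]

/-- The number which a term stands for. -/
noncomputable def value (b : ℙ K E) (t : ConfigTerm) : ℤ :=
  t.monomial.eval (Nat.card K : ℤ) * (realizations b t.2.2.toType).ncard

theorem value_one (b : ℙ K E) (τ : ConfigCode) :
    value b (false, 0, τ) = (realizations b τ.toType).ncard := by
  simp [value, monomial]

theorem value_xor_add (b : ℙ K E) (t u : ConfigTerm) :
    value b (xor t.1 u.1, t.2.1 + u.2.1, u.2.2) =
      t.monomial.eval (Nat.card K : ℤ) * value b u := by
  rw [value, monomial_xor_add, eval_mul, mul_assoc, value]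

end ConfigTerm

namespace ConfigCode

section Value

variable {K : Type v} [Field K] [Finite K] {E : Type w} [AddCommGroup E] [Module K E]
  [FiniteDimensional K E] {τ : ConfigCode} {p d : ℕ}

theorem sum_value_degenerations {R : Type u} [AddCommGroup R] (hτ : τ.WellFormed)
    (f : ConfigType ℕ → R) :
    ((τ.degenerations p).map fun υ => f υ.toType).sum =
      ∑ J ∈ (τ.toType.containing p).ssubsets, f (τ.toType.degenerate p J) := by
  have hnodup : ((τ.containing p).map List.toFinset).Nodup :=
    hτ.nodup_family.sublist (List.filter_sublist.map _)
  rw [← family_containing, family, ← sum_map_proper_sublists'_toFinset hnodup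
    fun J => f (τ.toType.degenerate p J)]
  simp only [degenerations, List.map_map, Function.comp_def, toType_degenerate, family]

theorem sum_value_expandAt (b : ℙ K E) (hτ : τ.WellFormed)
    (h : (p, d) ∈ τ.choices (Module.finrank K E)) :
    ((τ.expandAt (p, d)).map (ConfigTerm.value b)).sum = (realizations b τ.toType).ncard := by
  obtain ⟨hp, hfree⟩ := (mem_choices hτ).1 h
  have hremove : (((List.range d).map fun i => ((false, i, τ.remove p) : ConfigTerm)).map
      (ConfigTerm.value b)).sum =
      (∑ i ∈ Finset.range d, (Nat.card K : ℤ) ^ i) *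
        (realizations b (τ.toType.erase p)).ncard := by
    rw [List.map_map, ← toType_remove, Finset.sum_mul, ← List.toFinset_range,
      List.sum_toFinset _ List.nodup_range]
    simp [Function.comp_def, ConfigTerm.value, ConfigTerm.monomial]
  have hdegenerations : (((τ.degenerations p).map fun υ => ((true, 0, υ) : ConfigTerm)).map
      (ConfigTerm.value b)).sum = -∑ J ∈ (τ.toType.containing p).ssubsets,
        ((realizations b (τ.toType.degenerate p J)).ncard : ℤ) := by
    rw [List.map_map, ← sum_value_degenerations hτ fun C => ((realizations b C).ncard : ℤ),
      List.sum_neg, List.map_map]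
    simp [Function.comp_def, ConfigTerm.value, ConfigTerm.monomial]
  have hexpand := congrArg (Nat.cast : ℕ → ℤ) (ncard_realizations_expand b hp hfree)
  push_cast at hexpand
  rw [expandAt, List.map_append, List.sum_append, hremove, hdegenerations, ← hexpand,
    add_neg_cancel_right]

theorem sum_value_expand (b : ℙ K E) (hτ : τ.WellFormed) :
    ((τ.expand (Module.finrank K E)).map (ConfigTerm.value b)).sum =
      (realizations b τ.toType).ncard := by
  rw [expand]
  cases h : (τ.choices (Module.finrank K E)).head? with
  | none => simp [ConfigTerm.value_one]
  | some c => exact sum_value_expandAt b hτ (List.mem_of_mem_head? h)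

theorem sum_value_step (b : ℙ K E) {ts : List ConfigTerm} (h : ∀ t ∈ ts, WellFormed t.2.2) :
    ((step (Module.finrank K E) ts).map (ConfigTerm.value b)).sum =
      (ts.map (ConfigTerm.value b)).sum := by
  induction ts with
  | nil => rfl
  | cons t ts ih =>
    rw [List.forall_mem_cons] at h
    rw [step, List.flatMap_cons, List.map_append, List.sum_append, ← step, ih h.2, List.map_cons,
      List.sum_cons, List.map_map]
    simp only [Function.comp_def, ConfigTerm.value_xor_add]
    rw [List.sum_map_mul_left, sum_value_expand b h.1, ConfigTerm.value]

end Value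

variable {τ : ConfigCode} {n : ℕ} {t : ConfigTerm}

theorem expand_of_choices_eq_nil (h : τ.choices n = []) : τ.expand n = [(false, 0, τ)] := by
  simp [expand, h]

theorem exists_expand_eq_expandAt (h : τ.choices n ≠ []) :
    ∃ c ∈ τ.choices n, τ.expand n = τ.expandAt c := by
  refine ⟨_, List.head_mem h, ?_⟩
  rw [expand, List.head?_eq_some_head h, Option.map_some, Option.getD_some]

theorem size_remove_lt {p : ℕ} (hp : p ∈ τ.1) : (τ.remove p).size < τ.size := by
  refine Nat.add_lt_add_of_lt_of_le ?_ (List.length_filter_le _ _)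
  exact List.length_filter_lt_length_iff_exists.2 ⟨p, hp, by simp⟩

theorem size_lt_of_mem_degenerations {υ : ConfigCode} {p : ℕ} (h : υ ∈ τ.degenerations p) :
    υ.size < τ.size := by
  simp only [degenerations, List.mem_map, List.mem_filter, List.mem_sublists',
    decide_eq_true_eq] at h
  obtain ⟨N, ⟨hN, hne⟩, rfl⟩ := h
  have hlength :=
    (append_subperm_of_sublist_containing (List.Sublist.refl (τ.containing p))).length_le
  have hlt := lt_of_le_of_ne hN.length_le fun e => hne (hN.eq_of_length e)
  rw [List.length_append] at hlength
  simp only [size, List.length_append]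
  omega

theorem WellFormed.of_mem_degenerations {υ : ConfigCode} {p : ℕ} (hτ : τ.WellFormed)
    (h : υ ∈ τ.degenerations p) : υ.WellFormed ∧ υ.1 = τ.1 := by
  simp only [degenerations, List.mem_map, List.mem_filter, List.mem_sublists'] at h
  obtain ⟨N, ⟨hN, -⟩, rfl⟩ := h
  exact ⟨hτ.degenerate hN, rfl⟩

theorem WellFormed.of_mem_expand (hτ : τ.WellFormed) (ht : t ∈ τ.expand n) :
    WellFormed t.2.2 ∧ t.2.2.1.length ≤ τ.1.length := by
  by_cases h : τ.choices n = []
  · rw [expand_of_choices_eq_nil h, List.mem_singleton] at ht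
    exact ht ▸ ⟨hτ, le_rfl⟩
  · obtain ⟨⟨p, d⟩, -, hexpand⟩ := exists_expand_eq_expandAt h
    rw [hexpand, expandAt, List.mem_append, List.mem_map, List.mem_map] at ht
    obtain ⟨i, -, rfl⟩ | ⟨υ, hυ, rfl⟩ := ht
    · exact ⟨hτ.remove p, List.length_filter_le _ _⟩
    · exact ⟨(hτ.of_mem_degenerations hυ).1, (congrArg _ (hτ.of_mem_degenerations hυ).2).le⟩

theorem size_lt_of_mem_expand (h : τ.choices n ≠ []) (ht : t ∈ τ.expand n) :
    size t.2.2 < τ.size := by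
  obtain ⟨⟨p, d⟩, hpd, hexpand⟩ := exists_expand_eq_expandAt h
  rw [hexpand, expandAt, List.mem_append, List.mem_map, List.mem_map] at ht
  obtain ⟨i, -, rfl⟩ | ⟨υ, hυ, rfl⟩ := ht
  · obtain ⟨q, hq, hmem⟩ := List.mem_flatMap.1 hpd
    obtain rfl : q = p := by
      rw [List.mem_append, List.mem_ite_nil_right, List.mem_map] at hmem
      aesop
    exact size_remove_lt hq
  · exact size_lt_of_mem_degenerations hυ

theorem mem_step {ts : List ConfigTerm} (ht : t ∈ step n ts) :
    ∃ s ∈ ts, ∃ u ∈ expand n s.2.2, u.2.2 = t.2.2 := by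
  simp only [step, List.mem_flatMap, List.mem_map] at ht
  obtain ⟨s, hs, u, hu, rfl⟩ := ht
  exact ⟨s, hs, u, hu, rfl⟩

theorem WellFormed.of_mem_iterate_step (hτ : τ.WellFormed) (m : ℕ)
    (ht : t ∈ (step n)^[m] [(false, 0, τ)]) :
    WellFormed t.2.2 ∧ t.2.2.1.length ≤ τ.1.length := by
  induction m generalizing t with
  | zero => exact List.mem_singleton.1 ht ▸ ⟨hτ, le_rfl⟩
  | succ m ih =>
    rw [Function.iterate_succ_apply'] at ht
    obtain ⟨s, hs, u, hu, hut⟩ := mem_step ht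
    obtain ⟨hswf, hslength⟩ := ih hs
    obtain ⟨huwf, hulength⟩ := hswf.of_mem_expand hu
    exact hut ▸ ⟨huwf, hulength.trans hslength⟩

theorem choices_eq_nil_or_size_add_le (m : ℕ) (ht : t ∈ (step n)^[m] [(false, 0, τ)]) :
    choices n t.2.2 = [] ∨ size t.2.2 + m ≤ τ.size := by
  induction m generalizing t with
  | zero => exact List.mem_singleton.1 ht ▸ .inr le_rfl
  | succ m ih =>
    rw [Function.iterate_succ_apply'] at ht
    obtain ⟨s, hs, u, hu, hut⟩ := mem_step ht
    rw [← hut]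
    by_cases hnil : choices n s.2.2 = []
    · rw [expand_of_choices_eq_nil hnil, List.mem_singleton] at hu
      exact .inl (hu ▸ hnil)
    · have := (ih hs).resolve_left hnil
      have := size_lt_of_mem_expand hnil hu
      exact .inr (by omega)

theorem choices_eq_nil_of_mem_run (ht : t ∈ τ.run n) : choices n t.2.2 = [] := by
  refine (choices_eq_nil_or_size_add_le τ.size ht).elim id fun h => ?_
  have hpoints : t.2.2.1 = [] := List.eq_nil_of_length_eq_zero (by rw [size] at h; omega)
  rw [choices, hpoints, List.flatMap_nil]

theorem sum_value_run {K : Type v} [Field K] [Finite K] {E : Type w} [AddCommGroup E] [Module K E]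
    [FiniteDimensional K E] (b : ℙ K E) (hτ : τ.WellFormed) :
    ((τ.run (Module.finrank K E)).map (ConfigTerm.value b)).sum =
      (realizations b τ.toType).ncard := by
  rw [run]
  induction τ.size with
  | zero => simp [ConfigTerm.value_one]
  | succ m ih =>
    rw [Function.iterate_succ_apply',
      sum_value_step b fun t ht => (hτ.of_mem_iterate_step m ht).1, ih]

end ConfigCode

namespace PlanarSpace

variable {P : Type u} {Q : Type v} {f : PlanarSpace P} {g : PlanarSpace Q} {S T : Set P}

theorem Collinear.mono (h : f.Collinear T) (hST : S ⊆ T) : f.Collinear S :=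
  h.imp (fun h => h.anti hST) fun ⟨L, hL, h⟩ => ⟨L, hL, hST.trans h⟩

theorem Coplanar.mono (h : f.Coplanar T) (hST : S ⊆ T) : f.Coplanar S :=
  h.imp (fun h => h.mono hST) fun ⟨H, hH, h⟩ => ⟨H, hH, hST.trans h⟩

theorem collinear_iff_forall_encard_eq_three :
    f.Collinear S ↔ ∀ T ⊆ S, T.encard = 3 → f.Collinear T := by
  refine ⟨fun h T hT _ => h.mono hT, fun h => ?_⟩
  by_cases hsub : S.Subsingleton
  · exact .inl hsub
  obtain ⟨a, ha, b, hb, hab⟩ := Set.not_subsingleton_iff.1 hsub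
  obtain ⟨L, ⟨hL, haL, hbL⟩, hunique⟩ := f.existsUnique_line a b hab
  refine .inr ⟨L, hL, fun c hc => ?_⟩
  obtain rfl | hca := eq_or_ne c a
  · exact haL
  obtain rfl | hcb := eq_or_ne c b
  · exact hbL
  obtain htriple | ⟨L', hL', htriple⟩ := h {a, b, c}
    (by simp [Set.insert_subset_iff, ha, hb, hc])
    (Set.encard_eq_three.2 ⟨a, b, c, hab, hca.symm, hcb.symm, rfl⟩)
  · exact absurd (htriple (by simp) (by simp)) hab
  · exact hunique L' ⟨hL', htriple (by simp), htriple (by simp)⟩ ▸ htriple (by simp)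

theorem coplanar_iff_forall_encard_eq_four :
    f.Coplanar S ↔ ∀ T ⊆ S, T.encard = 4 → f.Coplanar T := by
  refine ⟨fun h T hT _ => h.mono hT, fun h => ?_⟩
  by_cases hcol : f.Collinear S
  · exact .inl hcol
  rw [collinear_iff_forall_encard_eq_three] at hcol
  push Not at hcol
  obtain ⟨T, hTS, hT3, hT⟩ := hcol
  obtain ⟨a, b, c, hab, hac, hbc, rfl⟩ := Set.encard_eq_three.1 hT3
  obtain ⟨H, ⟨hH, haH, hbH, hcH⟩, hunique⟩ := f.existsUnique_plane a b c hab hac hbc (by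
    rintro ⟨L, hL, ha, hb, hc⟩
    exact hT (.inr ⟨L, hL, by simp [Set.insert_subset_iff, ha, hb, hc]⟩))
  refine .inr ⟨H, hH, fun d hd => ?_⟩
  by_cases hdT : d ∈ ({a, b, c} : Set P)
  · obtain rfl | rfl | rfl := hdT <;> assumption
  obtain hquad | ⟨H', hH', hquad⟩ := h (insert d {a, b, c}) (Set.insert_subset hd hTS)
    (by rw [Set.encard_insert_of_notMem hdT, hT3]; rfl)
  · exact absurd (hquad.mono (Set.subset_insert _ _)) hT
  · exact hunique H' ⟨hH', hquad (by simp), hquad (by simp), hquad (by simp)⟩ ▸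
      hquad (by simp)

/-- Independent sets of points: sets of at most two points, non-collinear sets of three points, and
non-coplanar sets of four points. They determine the planar space up to the lines and planes which
carry no information. -/
def Indep (f : PlanarSpace P) (S : Set P) : Prop :=
  S.encard ≤ 2 ∨ (S.encard = 3 ∧ ¬f.Collinear S) ∨ (S.encard = 4 ∧ ¬f.Coplanar S)

theorem indep_iff_not_collinear (h : S.encard = 3) : f.Indep S ↔ ¬f.Collinear S := by
  simp [Indep, h, show ¬(3 : ℕ∞) ≤ 2 by decide]

theorem indep_iff_not_coplanar (h : S.encard = 4) : f.Indep S ↔ ¬f.Coplanar S := by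
  simp [Indep, h, show ¬(4 : ℕ∞) ≤ 2 by decide]

theorem collinear_iff_indep : f.Collinear S ↔ ∀ T ⊆ S, T.encard = 3 → ¬f.Indep T := by
  rw [collinear_iff_forall_encard_eq_three]
  exact forall₃_congr fun T _ h => by rw [indep_iff_not_collinear h, not_not]

theorem coplanar_iff_indep : f.Coplanar S ↔ ∀ T ⊆ S, T.encard = 4 → ¬f.Indep T := by
  rw [coplanar_iff_forall_encard_eq_four]
  exact forall₃_congr fun T _ h => by rw [indep_iff_not_coplanar h, not_not]

theorem iso_of_indep_iff (e : P ≃ Q) (h : ∀ S, g.Indep (e '' S) ↔ f.Indep S) : f.Iso g := by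
  have htransfer : ∀ (S : Set P) (k : ℕ∞), (∀ T ⊆ e '' S, T.encard = k → ¬g.Indep T) ↔
      ∀ T ⊆ S, T.encard = k → ¬f.Indep T := fun S k => by
    simp only [Set.forall_subset_image_iff, e.injective.encard_image, h]
  exact ⟨e, fun S => by rw [collinear_iff_indep, collinear_iff_indep, htransfer],
    fun S => by rw [coplanar_iff_indep, coplanar_iff_indep, htransfer]⟩

theorem Iso.exists_indep_iff (h : f.Iso g) : ∃ e : P ≃ Q, ∀ S, g.Indep (e '' S) ↔ f.Indep S := by
  obtain ⟨e, hcol, hcop⟩ := h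
  exact ⟨e, fun S => by simp only [Indep, hcol, hcop, e.injective.encard_image]⟩

section Realization

variable {K : Type w} [Field K] {ρ : P → ProjSpace3 K}

theorem inProjLine_image_iff :
    InProjLine (ρ '' S) ↔ Module.finrank K (pointSpan ρ S) ≤ 2 :=
  exists_finrank_eq_forall_submodule_le_iff (by simp)

theorem inProjPlane_image_iff :
    InProjPlane (ρ '' S) ↔ Module.finrank K (pointSpan ρ S) ≤ 3 :=
  exists_finrank_eq_forall_submodule_le_iff (by simp)

theorem StrongRealization.indep_iff (r : f.StrongRealization K) (S : Set P) :
    f.Indep S ↔ PointsIndep r.toFun S := by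
  have hthree (h : S.encard = 3) : f.Indep S ↔ PointsIndep r.toFun S := by
    rw [indep_iff_not_collinear h, ← r.line_iff, inProjLine_image_iff,
      pointsIndep_iff_of_encard_eq (k := 2) h]
  have hfour (h : S.encard = 4) : f.Indep S ↔ PointsIndep r.toFun S := by
    rw [indep_iff_not_coplanar h, ← r.plane_iff, inProjPlane_image_iff,
      pointsIndep_iff_of_encard_eq (k := 3) h]
  constructor
  · intro h
    obtain htwo | ⟨h3, -⟩ | ⟨h4, -⟩ := id h
    · exact pointsIndep_of_encard_le_two r.injective htwo
    · exact (hthree h3).1 h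
    · exact (hfour h4).1 h
  · intro h
    have hcard := h.encard_eq_finrank
    have hle : Module.finrank K (pointSpan r.toFun S) ≤ 4 :=
      (Submodule.finrank_le _).trans_eq (by simp)
    generalize Module.finrank K (pointSpan r.toFun S) = m at hcard hle
    interval_cases m
    · exact .inl (hcard.trans_le (by decide))
    · exact .inl (hcard.trans_le (by decide))
    · exact .inl (hcard.trans_le (by decide))
    · exact (hthree hcard).2 h
    · exact (hfour hcard).2 h

/-- A map with the right independent sets is a strong realization. -/
def StrongRealization.ofIndepIff (ρ : P → ProjSpace3 K)
    (h : ∀ S, f.Indep S ↔ PointsIndep ρ S) : f.StrongRealization K where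
  toFun := ρ
  injective a b hab := by
    by_contra hne
    exact (pointsIndep_pair_iff hne).1
      ((h {a, b}).1 (.inl (Set.encard_pair hne).le)) hab
  line_iff S := by
    rw [inProjLine_image_iff, finrank_pointSpan_le_iff, collinear_iff_indep]
    simp only [h]
    rfl
  plane_iff S := by
    rw [inProjPlane_image_iff, finrank_pointSpan_le_iff, coplanar_iff_indep]
    simp only [h]
    rfl

end Realization

end PlanarSpace

namespace ConfigType

section Models

variable {α : Type u} {P : Type v} {Q : Type w} {C C' : ConfigType α} {f : PlanarSpace P}
  {g : PlanarSpace Q} {φ : P → α}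

/-- The labelling `φ` of the points of `f` identifies the independent sets of `C` with those
of `f`. -/
structure IsLabelling (C : ConfigType α) (f : PlanarSpace P) (φ : P → α) : Prop where
  injective : Function.Injective φ
  coe_points : (C.points : Set α) = Set.range φ
  mem_indep_iff : ∀ A : Finset α, A ∈ C.indep ↔ ∃ S, f.Indep S ∧ φ '' S = A

/-- `C` is the combinatorial type of the planar space `f`, for some labelling. -/
def Models (C : ConfigType α) (f : PlanarSpace P) : Prop := ∃ φ, C.IsLabelling f φ

theorem IsLabelling.mem_indep (h : C.IsLabelling f φ) {A : Finset α} {S : Set P}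
    (hA : φ '' S = A) : A ∈ C.indep ↔ f.Indep S := by
  rw [h.mem_indep_iff, ← hA]
  simp [h.injective.image_injective.eq_iff]

theorem IsLabelling.exists_finset (h : C.IsLabelling f φ) (S : Set P) :
    ∃ A : Finset α, φ '' S = A :=
  ((C.points.finite_toSet.subset (h.coe_points ▸ Set.image_subset_range φ S)).exists_finset_coe).imp
    fun _ => Eq.symm

theorem IsLabelling.unique (h : C.IsLabelling f φ) (h' : C'.IsLabelling f φ) : C = C' := by
  obtain ⟨V, I⟩ := C
  obtain ⟨V', I'⟩ := C'
  congr
  · exact Finset.coe_injective (h.coe_points.trans h'.coe_points.symm)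
  · ext A
    exact (h.mem_indep_iff A).trans (h'.mem_indep_iff A).symm

/-- The type with labels renamed along `r`. -/
def map {β : Type*} [DecidableEq β] (r : α → β) (C : ConfigType α) : ConfigType β :=
  ⟨C.points.image r, C.indep.image (Finset.image r)⟩

theorem IsLabelling.map {β : Type*} [DecidableEq β] (h : C.IsLabelling f φ) {r : α → β}
    (hr : Set.InjOn r C.points) : (C.map r).IsLabelling f (r ∘ φ) where
  injective := (hr.injective_iff _ h.coe_points.ge).2 h.injective
  coe_points := by rw [ConfigType.map, Finset.coe_image, h.coe_points, Set.range_comp]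
  mem_indep_iff A := by
    simp only [ConfigType.map, Finset.mem_image, h.mem_indep_iff, Set.image_comp]
    constructor
    · rintro ⟨B, ⟨S, hS, hB⟩, rfl⟩
      exact ⟨S, hS, by rw [hB, Finset.coe_image]⟩
    · rintro ⟨S, hS, hA⟩
      obtain ⟨B, hB⟩ := h.exists_finset S
      exact ⟨B, ⟨S, hS, hB⟩, Finset.coe_injective (by rw [Finset.coe_image, ← hB, hA])⟩

theorem Models.of_iso (h : C.Models f) (hfg : f.Iso g) : C.Models g := by
  obtain ⟨φ, h⟩ := h
  obtain ⟨e, he⟩ := hfg.exists_indep_iff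
  refine ⟨φ ∘ e.symm, h.injective.comp e.symm.injective, ?_, fun A => ?_⟩
  · rw [h.coe_points, EquivLike.range_comp]
  · rw [h.mem_indep_iff, e.surjective.image_surjective.exists]
    simp only [he, Set.image_comp, e.symm_image_image]

theorem Models.iso (h : C.Models f) (h' : C.Models g) : f.Iso g := by
  obtain ⟨φ, h⟩ := h
  obtain ⟨ψ, h'⟩ := h'
  let e : P ≃ Q := (Equiv.ofInjective φ h.injective).trans
    ((Equiv.setCongr (h.coe_points.symm.trans h'.coe_points)).trans
      (Equiv.ofInjective ψ h'.injective).symm)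
  have he (p : P) : ψ (e p) = φ p := by simp [e, Equiv.apply_ofInjective_symm]
  refine PlanarSpace.iso_of_indep_iff e fun S => ?_
  obtain ⟨A, hA⟩ := h.exists_finset S
  have hA' : ψ '' (e '' S) = A := by simpa only [Set.image_image, he] using hA
  rw [← h.mem_indep hA, ← h'.mem_indep hA']

variable {K : Type w} [Field K] {b : ProjSpace3 K} {σ : α → ProjSpace3 K}

theorem IsLabelling.mem_realizations_iff (h : C.IsLabelling f φ) :
    σ ∈ realizations b C ↔ (∀ x ∉ Set.range φ, σ x = b) ∧
      ∀ S, f.Indep S ↔ PointsIndep (σ ∘ φ) S := by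
  rw [_root_.mem_realizations_iff, ← h.coe_points]
  refine and_congr_right fun _ => ?_
  constructor
  · intro hσ S
    obtain ⟨A, hA⟩ := h.exists_finset S
    have hAC : A ⊆ C.points := by
      rw [← Finset.coe_subset, ← hA, h.coe_points]
      exact Set.image_subset_range φ S
    rw [← h.mem_indep hA, hσ, and_iff_right hAC, ← hA, pointsIndep_image h.injective]
  · intro hσ A
    rw [h.mem_indep_iff, ← Finset.coe_subset, h.coe_points, Set.subset_range_iff_exists_image_eq]
    simp only [hσ]
    constructor
    · rintro ⟨S, hS, hA⟩
      exact ⟨⟨S, hA⟩, hA ▸ (pointsIndep_image h.injective S).2 hS⟩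
    · rintro ⟨⟨S, hA⟩, hindep⟩
      exact ⟨S, (pointsIndep_image h.injective S).1 (hA ▸ hindep), hA⟩

theorem Models.ncard_realizations (h : C.Models f) (b : ProjSpace3 K) :
    (realizations b C).ncard = f.numRealizations K := by
  obtain ⟨φ, h⟩ := h
  rw [← Nat.card_coe_set_eq, PlanarSpace.numRealizations]
  refine Nat.card_congr ⟨fun σ => .ofIndepIff (σ.1 ∘ φ) (h.mem_realizations_iff.1 σ.2).2,
    fun r => ⟨Function.extend φ r.toFun fun _ => b, h.mem_realizations_iff.2
      ⟨fun x hx => Function.extend_apply' _ _ _ hx, ?_⟩⟩, ?_, ?_⟩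
  · rw [Function.extend_comp h.injective]
    exact r.indep_iff
  · rintro ⟨σ, hσ⟩
    refine Subtype.ext (funext fun x => ?_)
    change Function.extend φ (σ ∘ φ) (fun _ => b) x = σ x
    by_cases hx : x ∈ Set.range φ
    · obtain ⟨p, rfl⟩ := hx
      rw [h.injective.extend_apply, Function.comp_apply]
    · rw [Function.extend_apply' _ _ _ hx]
      exact ((h.mem_realizations_iff.1 hσ).1 x hx).symm
  · intro r
    exact PlanarSpace.StrongRealization.ext_toFun
      (Function.extend_comp h.injective r.toFun fun _ => b)

end Models

end ConfigType

namespace PlanarCode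

/-- Independence of a set of labels in a description of a planar space. -/
def Indep (c : PlanarCode) (S : List ℕ) : Prop :=
  S.length ≤ 2 ∨ (S.length = 3 ∧ ¬∃ l ∈ c.2.1, S ⊆ l) ∨
    (S.length = 4 ∧ ¬(∃ l ∈ c.2.1, S ⊆ l) ∧ ¬∃ l ∈ c.2.2, S ⊆ l)

instance (c : PlanarCode) (S : List ℕ) : Decidable (c.Indep S) := by
  unfold Indep; infer_instance

/-- The combinatorial type of the points of the planar space described by `c`. -/
def type (c : PlanarCode) : ConfigCode :=
  (List.range c.1, (List.range c.1).sublists'.filter fun S => c.Indep S)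

theorem wellFormed_type (c : PlanarCode) : c.type.WellFormed where
  nodup_points := List.nodup_range
  nodup_of_mem T hT :=
    List.nodup_range.sublist (List.mem_sublists'.1 (List.mem_of_mem_filter hT))
  nodup_family := by
    refine List.Nodup.map_on (fun S hS T hT h => ?_)
      ((List.nodup_sublists'.2 List.nodup_range).filter _)
    have hsorted {S : List ℕ} (hS : S ∈ c.type.2) : S.Pairwise (· < ·) :=
      List.pairwise_lt_range.sublist (List.mem_sublists'.1 (List.mem_of_mem_filter hS))
    exact (hsorted hS).eq_of_mem_iff (hsorted hT) fun x => by
      rw [← List.mem_toFinset, h, List.mem_toFinset]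

variable {P : Type u} {f : PlanarSpace P} {c : PlanarCode}

theorem image_setOf_mem (e : P ≃ Fin c.1) {S : List ℕ}
    (hS : S ∈ (List.range c.1).sublists') :
    (fun p => (e p : ℕ)) '' {p | (e p : ℕ) ∈ S} = S.toFinset := by
  rw [List.coe_toFinset]
  exact Set.image_preimage_eq_of_subset (f := fun p => (e p : ℕ)) fun x hx =>
    ⟨e.symm ⟨x, List.mem_range.1 ((List.mem_sublists'.1 hS).subset hx)⟩, by simp⟩

theorem encard_setOf_mem (e : P ≃ Fin c.1) {S : List ℕ}
    (hS : S ∈ (List.range c.1).sublists') : {p | (e p : ℕ) ∈ S}.encard = S.length := by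
  rw [← (Fin.val_injective.comp e.injective).encard_image, Function.comp_def,
    image_setOf_mem e hS, Set.encard_coe_eq_coe_finsetCard,
    List.toFinset_card_of_nodup (List.nodup_range.sublist (List.mem_sublists'.1 hS))]

theorem setOf_mem_subset_iff (e : P ≃ Fin c.1) {S l : List ℕ}
    (hS : S ∈ (List.range c.1).sublists') :
    {p | (e p : ℕ) ∈ S} ⊆ {p | (e p : ℕ) ∈ l} ↔ S ⊆ l := by
  refine (Set.image_subset_iff (f := fun p => (e p : ℕ)) (t := {x | x ∈ l})).symm.trans ?_
  rw [image_setOf_mem e hS, List.coe_toFinset]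
  rfl

theorem indep_iff (e : P ≃ Fin c.1)
    (hlines : f.lines = {L | ∃ l ∈ c.2.1, L = {p | (e p : ℕ) ∈ l}})
    (hplanes : f.planes = {H | ∃ l ∈ c.2.2, H = {p | (e p : ℕ) ∈ l}}) {S : List ℕ}
    (hS : S ∈ (List.range c.1).sublists') : c.Indep S ↔ f.Indep {p | (e p : ℕ) ∈ S} := by
  have hline : (∃ L ∈ f.lines, {p | (e p : ℕ) ∈ S} ⊆ L) ↔ ∃ l ∈ c.2.1, S ⊆ l := by
    simp [hlines, setOf_mem_subset_iff e hS]
  have hplane : (∃ H ∈ f.planes, {p | (e p : ℕ) ∈ S} ⊆ H) ↔ ∃ l ∈ c.2.2, S ⊆ l := by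
    simp [hplanes, setOf_mem_subset_iff e hS]
  have hcollinear (h : 2 ≤ S.length) :
      f.Collinear {p | (e p : ℕ) ∈ S} ↔ ∃ l ∈ c.2.1, S ⊆ l := by
    rw [PlanarSpace.Collinear, hline, or_iff_right]
    rw [← Set.encard_le_one_iff_subsingleton, encard_setOf_mem e hS]
    exact_mod_cast (show ¬S.length ≤ 1 by omega)
  rw [Indep, PlanarSpace.Indep, encard_setOf_mem e hS, PlanarSpace.Coplanar, hplane]
  norm_cast
  refine or_congr_right (or_congr (and_congr_right fun h => ?_) (and_congr_right fun h => ?_))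
  · rw [hcollinear (by omega)]
  · rw [hcollinear (by omega), not_or]

theorem Describes.natCard_eq (h : c.Describes f) : Nat.card P = c.1 := by
  obtain ⟨e, -⟩ := h
  rw [Nat.card_congr e, Nat.card_fin]

theorem Describes.models (h : c.Describes f) : c.type.toType.Models f := by
  obtain ⟨e, hlines, hplanes⟩ := h
  have hinj : Function.Injective fun p => (e p : ℕ) := Fin.val_injective.comp e.injective
  have hpoints : ((c.type.toType.points : Finset ℕ) : Set ℕ) = Set.range fun p => (e p : ℕ) := by
    ext x
    simp only [ConfigCode.toType, type, List.coe_toFinset, Set.mem_ofPred_eq, List.mem_range]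
    exact ⟨fun hx => ⟨e.symm ⟨x, hx⟩, by simp⟩, by rintro ⟨p, rfl⟩; exact (e p).2⟩
  refine ⟨fun p => e p, hinj, hpoints, fun A => ?_⟩
  simp only [ConfigCode.toType, family, type, List.mem_toFinset, List.mem_map, List.mem_filter,
    decide_eq_true_eq]
  constructor
  · rintro ⟨S, ⟨hS, hindep⟩, rfl⟩
    exact ⟨_, (indep_iff e hlines hplanes hS).1 hindep, image_setOf_mem e hS⟩
  · rintro ⟨S, hindep, hA⟩
    have hsub : (List.range c.1).filter (· ∈ A) ∈ (List.range c.1).sublists' := by simp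
    have hS : {p | (e p : ℕ) ∈ (List.range c.1).filter (· ∈ A)} = S := by
      ext p
      rw [Set.mem_ofPred_eq, List.mem_filter, decide_eq_true_eq, ← Finset.mem_coe, ← hA,
        hinj.mem_set_image, List.mem_range, and_iff_right (e p).2]
    refine ⟨_, ⟨hsub, (indep_iff e hlines hplanes hsub).2 (hS ▸ hindep)⟩, ?_⟩
    rw [← Finset.coe_inj, ← image_setOf_mem e hsub, hS, hA]

end PlanarCode

/-- All lists of length `n` of members of `V`. -/
def tuples (V : List ℕ) (n : ℕ) : List (List ℕ) :=
  Nat.rec [[]] (fun _ T => T.flatMap fun l => V.map fun x => x :: l) n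

theorem mem_tuples {V : List ℕ} {n : ℕ} {l : List ℕ} :
    l ∈ tuples V n ↔ l.length = n ∧ l ⊆ V := by
  induction n generalizing l with
  | zero => exact List.mem_singleton.trans ⟨by rintro rfl; simp, fun h => by simpa using h.1⟩
  | succ n ih =>
    have hsucc : tuples V (n + 1) = (tuples V n).flatMap fun l => V.map fun x => x :: l := rfl
    simp only [hsucc, List.mem_flatMap, List.mem_map, ih]
    constructor
    · rintro ⟨l, ⟨rfl, hl⟩, x, hx, rfl⟩
      exact ⟨rfl, List.cons_subset.2 ⟨hx, hl⟩⟩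
    · rintro ⟨hlength, hl⟩
      obtain ⟨x, l, rfl⟩ := List.exists_cons_of_length_eq_add_one hlength
      obtain ⟨hx, hl⟩ := List.cons_subset.1 hl
      exact ⟨l, ⟨Nat.succ_injective hlength, hl⟩, x, hx, rfl⟩

namespace ConfigCode

/-- Some renaming of the labels, given by the list of the new labels, turns the type of the planar
space described by `d` into the type `τ`. -/
def MatchesCode (τ : ConfigCode) (d : PlanarCode) : Prop :=
  τ.1.length = d.1 ∧ ∃ l ∈ tuples τ.1 d.1, d.type.toType.map (fun i => l.getD i 0) = τ.toType

instance (τ d) : Decidable (MatchesCode τ d) := by unfold MatchesCode; infer_instance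

variable {P : Type u} {f : PlanarSpace P} {τ : ConfigCode} {d : PlanarCode}

theorem card_points_type (d : PlanarCode) : d.type.toType.points.card = d.1 := by
  rw [toType, PlanarCode.type, List.toFinset_range, Finset.card_range]

theorem MatchesCode.models (h : τ.MatchesCode d) (hτ : τ.1.Nodup) (hd : d.Describes f) :
    τ.toType.Models f := by
  obtain ⟨hlength, l, -, hl⟩ := h
  obtain ⟨φ, hφ⟩ := hd.models
  refine ⟨_, hl ▸ hφ.map (Finset.injOn_of_card_image_eq ?_)⟩
  rw [card_points_type, ← hlength, ← List.toFinset_card_of_nodup hτ]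
  exact congrArg (fun C => C.points.card) hl

theorem matchesCode_of_models (h : τ.toType.Models f) (hτ : τ.1.Nodup) (hd : d.Describes f) :
    τ.MatchesCode d := by
  obtain ⟨φ, hφ⟩ := h
  obtain ⟨ψ, hψ⟩ := hd.models
  let l := (List.range d.1).map (Function.extend ψ φ fun _ => 0)
  have hmem (i : ℕ) : i ∈ d.type.toType.points ↔ i < d.1 := by
    simp [toType, PlanarCode.type]
  have hget : (fun i => l.getD i 0) ∘ ψ = φ := by
    ext p
    have hp : ψ p < d.1 := (hmem _).1 (by rw [← Finset.mem_coe, hψ.coe_points]; exact ⟨p, rfl⟩)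
    simp [l, hp, hψ.injective.extend_apply]
  have hrange {i : ℕ} (hi : i < d.1) : ∃ p, ψ p = i := by
    rwa [← Set.mem_range, ← hψ.coe_points, Finset.mem_coe, hmem]
  have hinj : Set.InjOn (fun i => l.getD i 0) d.type.toType.points := by
    rw [hψ.coe_points]
    exact (hget.symm ▸ hφ.injective).injOn_range
  have hmap : d.type.toType.map (fun i => l.getD i 0) = τ.toType :=
    (hψ.map hinj).unique (hget ▸ hφ)
  refine ⟨?_, l, mem_tuples.2 ⟨by simp [l], fun x hx => ?_⟩, hmap⟩
  · rw [← List.toFinset_card_of_nodup hτ, ← card_points_type d, ← Finset.card_image_of_injOn hinj]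
    exact congrArg (fun C => C.points.card) hmap.symm
  · obtain ⟨i, hi, rfl⟩ := List.mem_map.1 hx
    obtain ⟨p, rfl⟩ := hrange (List.mem_range.1 hi)
    rw [hψ.injective.extend_apply, ← List.mem_toFinset, ← Finset.mem_coe]
    exact hφ.coe_points ▸ ⟨p, rfl⟩

theorem matchesCode_iff (hτ : τ.1.Nodup) (hd : d.Describes f) :
    τ.MatchesCode d ↔ τ.toType.Models f :=
  ⟨fun h => h.models hτ hd, fun h => matchesCode_of_models h hτ hd⟩

end ConfigCode

/-- The coefficients of the polynomial part of the expansion. -/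
def polyPart (c : PlanarCode) : List ℤ :=
  ConfigTerm.coeffs ((c.type.run 4).filter fun t => t.2.2.1 = [] ∧ family t.2.2.2 = {∅})

/-- The coefficients of the polynomial with which the hyperfiguration described by `d` occurs in
the expansion. -/
def hyperPart (c d : PlanarCode) : List ℤ :=
  ConfigTerm.coeffs ((c.type.run 4).filter fun t => ¬t.2.2.1 = [] ∧ t.2.2.MatchesCode d)

section Primrec

open Primrec

variable {α : Type u} {β : Type v} [Primcodable α] [Primcodable β]

theorem primrecPred_forall_mem {l : α → List β} {R : α → β → Prop} (hl : Primrec l)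
    (hR : PrimrecPred fun x : α × β => R x.1 x.2) : PrimrecPred fun a => ∀ b ∈ l a, R a b :=
  have h : PrimrecRel fun (b : β) (a : α) => R a b :=
    hR.comp (f := fun x : β × α => (x.2, x.1)) (snd.pair fst)
  h.forall_mem_list.comp hl .id

theorem primrecPred_exists_mem {l : α → List β} {R : α → β → Prop} (hl : Primrec l)
    (hR : PrimrecPred fun x : α × β => R x.1 x.2) : PrimrecPred fun a => ∃ b ∈ l a, R a b :=
  have h : PrimrecRel fun (b : β) (a : α) => R a b :=
    hR.comp (f := fun x : β × α => (x.2, x.1)) (snd.pair fst)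
  h.exists_mem_list.comp hl .id

theorem primrec_filter {l : α → List β} {R : α → β → Prop} [∀ a b, Decidable (R a b)]
    (hl : Primrec l) (hR : PrimrecPred fun x : α × β => R x.1 x.2) :
    Primrec fun a => (l a).filter fun b => R a b :=
  have h : PrimrecRel fun (b : β) (a : α) => R a b :=
    hR.comp (f := fun x : β × α => (x.2, x.1)) (snd.pair fst)
  letI : DecidableRel fun (b : β) (a : α) => R a b := fun _ _ => inferInstance
  h.listFilter.comp hl .id

theorem primrec_sublists' : Primrec (List.sublists' : List α → List (List α)) := by
  have h : Primrec fun l : List α => l.foldr (fun a s => s ++ s.map fun t => a :: t) [[]] :=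
    list_foldr (f := fun l : List α => l) (g := fun _ => [[]])
      (h := fun _ (x : α × List (List α)) => x.2 ++ x.2.map fun t => x.1 :: t) .id (.const _)
      (list_append.comp (snd.comp snd)
        (list_map (snd.comp snd) (list_cons.comp (fst.comp (snd.comp fst)) snd)))
  refine h.of_eq fun l => ?_
  induction l with
  | nil => rfl
  | cons a l ih => rw [List.foldr_cons, ih, List.sublists'_cons]

theorem primrec_list_mem : PrimrecRel fun (a : α) (l : List α) => a ∈ l :=
  (primrecPred_exists_mem (l := fun x : α × List α => x.2) (R := fun x b => b = x.1) snd
    (Primrec.eq.comp snd (fst.comp fst))).of_eq fun x => by simp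

theorem primrec_list_subset : PrimrecRel fun (l m : List α) => l ⊆ m :=
  primrecPred_forall_mem (l := fun x : List α × List α => x.1) (R := fun x b => b ∈ x.2) fst
    (primrec_list_mem.comp snd (snd.comp fst))

theorem primrec_toFinset_eq [DecidableEq α] :
    PrimrecRel fun l m : List α => l.toFinset = m.toFinset :=
  (primrec_list_subset.and (primrec_list_subset.comp snd fst)).of_eq fun x => by
    change _ ↔ x.1.toFinset = x.2.toFinset
    simp [subset_antisymm_iff, Finset.subset_iff, List.subset_def]

theorem primrec_list_sum : Primrec (List.sum : List ℕ → ℕ) :=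
  list_foldr (f := fun l : List ℕ => l) (g := fun _ => 0) (h := fun _ x => x.1 + x.2) .id
    (.const _) (nat_add.comp (fst.comp snd) (snd.comp snd))

theorem primrec_int_subNatNat : Primrec₂ Int.subNatNat := by
  have hofNat : Primrec Int.ofNat :=
    Primrec.encode_iff.1 ((nat_mul.comp (.const 2) .id).of_eq fun n => rfl)
  have hnegSucc : Primrec Int.negSucc :=
    Primrec.encode_iff.1 ((succ.comp (nat_mul.comp (.const 2) .id)).of_eq fun n => rfl)
  refine (nat_casesOn (f := fun x : ℕ × ℕ => x.2 - x.1) (g := fun x => Int.ofNat (x.1 - x.2))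
    (h := fun _ k => Int.negSucc k) (nat_sub.comp snd fst) (hofNat.comp (nat_sub.comp fst snd))
    (hnegSucc.comp snd)).of_eq fun x => ?_
  simp only [Int.subNatNat]
  cases x.2 - x.1 <;> rfl

theorem primrec_toFinset_mem_family :
    PrimrecRel fun (S : List ℕ) (M : List (List ℕ)) => S.toFinset ∈ family M :=
  (primrecPred_exists_mem (R := fun x T => T.toFinset = x.1.toFinset) snd
    (primrec_toFinset_eq.comp snd (fst.comp fst))).of_eq fun x => by simp [family]

theorem primrec_family_eq : PrimrecRel fun M N : List (List ℕ) => family M = family N := by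
  have hsubset : PrimrecRel fun M N : List (List ℕ) => ∀ S ∈ M, S.toFinset ∈ family N :=
    primrecPred_forall_mem fst (primrec_toFinset_mem_family.comp snd (snd.comp fst))
  refine (hsubset.and (hsubset.comp snd fst)).of_eq fun x => ?_
  change _ ↔ family x.1 = family x.2
  rw [subset_antisymm_iff]
  simp [Finset.subset_iff, family]

namespace ConfigCode

theorem forall_mem_avoiding_iff {τ : ConfigCode} {p : ℕ} {R : Finset ℕ → Prop} :
    (∀ T ∈ τ.avoiding p, R T.toFinset) ↔ ∀ S ∈ τ.toType.avoiding p, R S := by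
  simp [← family_avoiding, family]

theorem primrec_spans : PrimrecPred fun x : ConfigCode × List ℕ × ℕ =>
    x.1.toType.Spans x.2.1.toFinset x.2.2 :=
  ((primrec_list_mem.comp (snd.comp snd) (fst.comp snd)).or
    (primrec_toFinset_mem_family.comp (list_cons.comp (snd.comp snd) (fst.comp snd))
      (snd.comp fst)).not).of_eq fun x => by
    simp [ConfigType.Spans, toType]

theorem primrec_avoiding : Primrec₂ avoiding :=
  primrec_filter (R := fun (x : ConfigCode × ℕ) (S : List ℕ) => ¬x.2 ∈ S) (snd.comp fst)
    (primrec_list_mem.comp (snd.comp fst) snd).not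

theorem primrec_containing : Primrec₂ containing :=
  primrec_filter (R := fun (x : ConfigCode × ℕ) (S : List ℕ) => x.2 ∈ S) (snd.comp fst)
    (primrec_list_mem.comp (snd.comp fst) snd)

theorem primrec_isFree : PrimrecRel fun (τ : ConfigCode) p => τ.toType.IsFree p :=
  (primrecPred_forall_mem (R := fun x S => ¬x.1.toType.Spans S.toFinset x.2) primrec_avoiding
    (primrec_spans.comp ((fst.comp fst).pair (snd.pair (snd.comp fst)))).not).of_eq fun x =>
      forall_mem_avoiding_iff (R := fun S => ¬x.1.toType.Spans S x.2)

theorem primrec_isMeet : PrimrecPred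
    fun x : (ConfigCode × ℕ) × List ℕ × List ℕ × List ℕ =>
      x.1.1.toType.IsMeet x.1.2 x.2.1.toFinset x.2.2.1.toFinset x.2.2.2.toFinset := by
  have hF : Primrec fun x : (ConfigCode × ℕ) × List ℕ × List ℕ × List ℕ => x.2.1 :=
    fst.comp snd
  have hG : Primrec fun x : (ConfigCode × ℕ) × List ℕ × List ℕ × List ℕ => x.2.2.1 :=
    fst.comp (snd.comp snd)
  have hB : Primrec fun x : (ConfigCode × ℕ) × List ℕ × List ℕ × List ℕ => x.2.2.2 :=
    snd.comp (snd.comp snd)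
  have hτ : Primrec fun x : (ConfigCode × ℕ) × List ℕ × List ℕ × List ℕ => x.1.1 :=
    fst.comp fst
  have hp : Primrec fun x : (ConfigCode × ℕ) × List ℕ × List ℕ × List ℕ => x.1.2 :=
    snd.comp fst
  have hforall {S : ((ConfigCode × ℕ) × List ℕ × List ℕ × List ℕ) × List ℕ → List ℕ}
      (hS : Primrec S) : PrimrecPred fun x => ∀ y ∈ S x, x.1.1.1.toType.Spans x.2.toFinset y :=
    primrecPred_forall_mem hS
      (primrec_spans.comp ((hτ.comp (fst.comp fst)).pair ((snd.comp fst).pair snd)))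
  have hminimal := primrecPred_forall_mem (primrec_avoiding.comp hτ hp)
    (R := fun x S => ¬x.1.1.toType.Spans S.toFinset x.1.2 ∨
      (∀ y ∈ x.2.1, x.1.1.toType.Spans S.toFinset y) ∨
        ∀ y ∈ x.2.2.1, x.1.1.toType.Spans S.toFinset y)
    ((primrec_spans.comp ((hτ.comp fst).pair (snd.pair (hp.comp fst)))).not.or
      ((hforall (hF.comp fst)).or (hforall (hG.comp fst))))
  refine (((primrec_spans.comp (hτ.pair (hF.pair hp))).and
    (primrec_spans.comp (hτ.pair (hG.pair hp)))).and
    (((primrec_list_subset.comp hB (list_append.comp hF hG)).and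
      ((hforall (list_append.comp (hF.comp fst) (hG.comp fst))).comp (.pair .id hB))).and
      hminimal)).of_eq fun x => ?_
  rw [ConfigType.IsMeet, ← forall_mem_avoiding_iff]
  simp [Finset.subset_iff, List.subset_def, imp_iff_not_or]

theorem primrec_triples : Primrec triples :=
  list_flatMap .id (list_flatMap fst (list_map (fst.comp fst)
    ((snd.comp (fst.comp fst)).pair ((snd.comp fst).pair snd))))

theorem primrec_choices (n : ℕ) : Primrec (choices n) :=
  list_flatMap fst (list_append.comp
    (Primrec.ite primrec_isFree (list_cons.comp (snd.pair (.const n)) (.const [])) (.const []))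
    (list_map (primrec_filter (primrec_triples.comp primrec_avoiding) primrec_isMeet)
      ((snd.comp fst).pair (nat_sub.comp
        (nat_add.comp (list_length.comp (fst.comp snd))
          (list_length.comp (fst.comp (snd.comp snd))))
        (list_length.comp (snd.comp (snd.comp snd)))))))

theorem primrec_degenerations : Primrec₂ degenerations :=
  list_map (primrec_filter (primrec_sublists'.comp primrec_containing)
      (Primrec.eq.comp snd (primrec_containing.comp (fst.comp fst) (snd.comp fst))).not)
    ((fst.comp (fst.comp fst)).pair
      (list_append.comp (primrec_avoiding.comp (fst.comp fst) (snd.comp fst)) snd))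

theorem primrec_remove : Primrec₂ remove :=
  (primrec_filter (fst.comp fst) (Primrec.eq.comp snd (snd.comp fst)).not).pair primrec_avoiding

theorem primrec_expandAt : Primrec₂ expandAt :=
  list_append.comp
    (list_map (list_range.comp (snd.comp snd)) ((Primrec.const false).pair
      (snd.pair (primrec_remove.comp (fst.comp fst) (fst.comp (snd.comp fst))))))
    (list_map (primrec_degenerations.comp fst (fst.comp snd))
      ((Primrec.const true).pair ((Primrec.const 0).pair snd)))

theorem primrec_expand (n : ℕ) : Primrec (expand n) :=
  option_getD.comp (option_map (list_head?.comp (primrec_choices n)) primrec_expandAt)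
    (list_cons.comp ((Primrec.const false).pair ((Primrec.const 0).pair .id)) (.const []))

theorem primrec_step (n : ℕ) : Primrec (step n) :=
  list_flatMap .id (list_map ((primrec_expand n).comp (snd.comp (snd.comp snd)))
    (((dom_bool₂ xor).comp (fst.comp (snd.comp fst)) (fst.comp snd)).pair
      ((nat_add.comp (fst.comp (snd.comp (snd.comp fst))) (fst.comp (snd.comp snd))).pair
        (snd.comp (snd.comp snd)))))

theorem primrec_run (n : ℕ) : Primrec (run n) :=
  nat_iterate (nat_add.comp (list_length.comp fst) (list_length.comp snd))
    (list_cons.comp ((Primrec.const false).pair ((Primrec.const 0).pair .id)) (.const []))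
    ((primrec_step n).comp snd)

end ConfigCode

theorem primrec_tuples : Primrec₂ tuples :=
  nat_rec' (f := fun x : List ℕ × ℕ => x.2) (g := fun _ => [[]])
    (h := fun x (y : ℕ × List (List ℕ)) => y.2.flatMap fun l => x.1.map fun a => a :: l) snd
    (.const _) (list_flatMap (snd.comp snd) (list_map (fst.comp (fst.comp fst))
      (list_cons.comp snd (snd.comp fst))))

namespace PlanarCode

theorem primrec_indep : PrimrecRel Indep :=
  have hlength : Primrec fun x : PlanarCode × List ℕ => x.2.length := list_length.comp snd
  have hlines : PrimrecPred fun x : PlanarCode × List ℕ => ∃ l ∈ x.1.2.1, x.2 ⊆ l :=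
    primrecPred_exists_mem (fst.comp (snd.comp fst))
      (primrec_list_subset.comp (snd.comp fst) snd)
  have hplanes : PrimrecPred fun x : PlanarCode × List ℕ => ∃ l ∈ x.1.2.2, x.2 ⊆ l :=
    primrecPred_exists_mem (snd.comp (snd.comp fst))
      (primrec_list_subset.comp (snd.comp fst) snd)
  (nat_le.comp hlength (.const 2)).or (((Primrec.eq.comp hlength (.const 3)).and hlines.not).or
    ((Primrec.eq.comp hlength (.const 4)).and (hlines.not.and hplanes.not)))

theorem primrec_type : Primrec type :=
  (list_range.comp fst).pair
    (primrec_filter (primrec_sublists'.comp (list_range.comp fst)) primrec_indep)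

end PlanarCode

theorem ConfigCode.map_toType (τ : ConfigCode) (r : ℕ → ℕ) :
    τ.toType.map r = toType (τ.1.map r, τ.2.map (List.map r)) := by
  have himage (l : List ℕ) : l.toFinset.image r = (l.map r).toFinset := by ext; simp
  ext <;> simp [ConfigType.map, toType, family, himage]

theorem ConfigCode.primrec_matchesCode : PrimrecRel ConfigCode.MatchesCode := by
  have hrename : Primrec₂ fun (x : (ConfigCode × PlanarCode) × List ℕ) (i : ℕ) => x.2.getD i 0 :=
    (list_getD 0).comp (snd.comp fst) snd
  have htype : Primrec fun x : (ConfigCode × PlanarCode) × List ℕ => x.1.2.type :=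
    PlanarCode.primrec_type.comp (snd.comp fst)
  have hpoints : PrimrecPred fun x : (ConfigCode × PlanarCode) × List ℕ =>
      (x.1.2.type.1.map fun i => x.2.getD i 0).toFinset = x.1.1.1.toFinset :=
    primrec_toFinset_eq.comp (list_map (fst.comp htype) hrename) (fst.comp (fst.comp fst))
  have hindep : PrimrecPred fun x : (ConfigCode × PlanarCode) × List ℕ =>
      family (x.1.2.type.2.map (List.map fun i => x.2.getD i 0)) = family x.1.1.2 :=
    primrec_family_eq.comp (list_map (snd.comp htype)
      (list_map snd (hrename.comp (fst.comp fst) snd))) (snd.comp (fst.comp fst))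
  refine (Primrec.eq.comp (list_length.comp (fst.comp fst)) (fst.comp snd)).and
    (primrecPred_exists_mem (primrec_tuples.comp (fst.comp fst) (fst.comp snd))
      ((hpoints.and hindep).of_eq fun x => ?_))
  rw [map_toType, ConfigType.ext_iff]
  exact Iff.rfl

theorem ConfigTerm.primrec_coeffs : Primrec ConfigTerm.coeffs := by
  have h (b : Bool) : Primrec fun x : List ConfigTerm × ℕ =>
      (x.1.filter fun t => t.1 = b ∧ t.2.1 = x.2).length :=
    list_length.comp (primrec_filter (R := fun (x : List ConfigTerm × ℕ) (t : ConfigTerm) =>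
        t.1 = b ∧ t.2.1 = x.2) fst
      ((Primrec.eq.comp (fst.comp snd) (.const b)).and
        (Primrec.eq.comp (fst.comp (snd.comp snd)) (snd.comp fst))))
  exact list_map (list_range.comp (succ.comp (primrec_list_sum.comp
    (list_map .id (fst.comp (snd.comp snd)))))) (primrec_int_subNatNat.comp (h false) (h true))

theorem primrec_polyPart : Primrec polyPart :=
  ConfigTerm.primrec_coeffs.comp (primrec_filter
    ((ConfigCode.primrec_run 4).comp PlanarCode.primrec_type)
    ((Primrec.eq.comp (fst.comp (snd.comp (snd.comp snd))) (.const [])).and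
      (primrec_family_eq.comp (snd.comp (snd.comp (snd.comp snd))) (.const [[]]))))

theorem primrec_hyperPart : Primrec₂ hyperPart :=
  ConfigTerm.primrec_coeffs.comp (primrec_filter
    ((ConfigCode.primrec_run 4).comp (PlanarCode.primrec_type.comp fst))
    ((Primrec.eq.comp (fst.comp (snd.comp (snd.comp snd))) (.const [])).not.and
      (ConfigCode.primrec_matchesCode.comp (snd.comp (snd.comp snd)) (snd.comp fst))))

end Primrec

section Trace

variable {P : Type u} {K : Type v} [Field K] {E : Type w} [AddCommGroup E] [Module K E]
  {ρ : P → ℙ K E} {W : Submodule K E} {S : Set P}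

/-- The labels of the points which lie in a subspace. -/
def traceOf (ρ : P → ℙ K E) (W : Submodule K E) : Set P := {x | (ρ x).rep ∈ W}

theorem subset_traceOf_iff : S ⊆ traceOf ρ W ↔ pointSpan ρ S ≤ W := pointSpan_le_iff.symm

theorem PointsIndep.pointSpan_eq [FiniteDimensional K E] (h : PointsIndep ρ S)
    (hcard : S.encard = Module.finrank K W) (hS : S ⊆ traceOf ρ W) : pointSpan ρ S = W := by
  rw [h.encard_eq_finrank, Nat.cast_inj] at hcard
  exact Submodule.eq_of_le_of_finrank_eq (subset_traceOf_iff.1 hS) hcard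

end Trace

section TraceSpace

variable {P : Type u} {K : Type v} [Field K] {ρ : P → ProjSpace3 K} {S : Set P}

theorem inProjLine_image_iff_subset_traceOf : InProjLine (ρ '' S) ↔
    ∃ W : Submodule K (Fin 4 → K), Module.finrank K W = 2 ∧ S ⊆ traceOf ρ W := by
  simp only [InProjLine, Set.forall_mem_image, submodule_le_iff_rep_mem]
  rfl

theorem inProjPlane_image_iff_subset_traceOf : InProjPlane (ρ '' S) ↔
    ∃ W : Submodule K (Fin 4 → K), Module.finrank K W = 3 ∧ S ⊆ traceOf ρ W := by
  simp only [InProjPlane, Set.forall_mem_image, submodule_le_iff_rep_mem]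
  rfl

theorem inProjLine_image_of_subsingleton (hS : S.Subsingleton) : InProjLine (ρ '' S) := by
  rw [PlanarSpace.inProjLine_image_iff, finrank_pointSpan_le_iff]
  intro T hTS hT
  have := Set.encard_le_one_iff_subsingleton.2 (hS.anti hTS)
  exact absurd (hT ▸ this) (by decide)

theorem InProjLine.inProjPlane_image (h : InProjLine (ρ '' S)) : InProjPlane (ρ '' S) := by
  rw [PlanarSpace.inProjLine_image_iff] at h
  exact PlanarSpace.inProjPlane_image_iff.2 (h.trans (by decide))

/-- The planar space of a family of distinct points of projective space. A plane of projective space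
is kept even if its points are collinear or absent; this does not affect coplanarity. -/
def traceSpace (ρ : P → ProjSpace3 K) (hρ : Function.Injective ρ) : PlanarSpace P where
  lines := {L | (∃ W : Submodule K (Fin 4 → K), Module.finrank K W = 2 ∧ L = traceOf ρ W) ∧
    L.Nontrivial}
  planes := {H | ∃ W : Submodule K (Fin 4 → K), Module.finrank K W = 3 ∧ H = traceOf ρ W}
  existsUnique_line a b hab := by
    have hindep : PointsIndep ρ {a, b} := (pointsIndep_pair_iff hab).2 (hρ.ne hab)
    have hrank : Module.finrank K (pointSpan ρ {a, b}) = 2 := by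
      exact_mod_cast hindep.encard_eq_finrank.symm.trans (Set.encard_pair hab)
    have ha : a ∈ traceOf ρ (pointSpan ρ {a, b}) := rep_mem_pointSpan ρ (by simp)
    have hb : b ∈ traceOf ρ (pointSpan ρ {a, b}) := rep_mem_pointSpan ρ (by simp)
    refine ⟨_, ⟨⟨⟨_, hrank, rfl⟩, a, ha, b, hb, hab⟩, ha, hb⟩, ?_⟩
    rintro _ ⟨⟨⟨W, hW, rfl⟩, -⟩, haW, hbW⟩
    rw [hindep.pointSpan_eq (by rw [Set.encard_pair hab, hW]; rfl) (Set.pair_subset haW hbW)]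
  nontrivial_of_line := by
    rintro L ⟨-, a, ha, b, hb, hab⟩
    exact ⟨a, ha, b, hb, hab⟩
  existsUnique_plane a b c hab hac hbc hline := by
    have hthree : ({a, b, c} : Set P).encard = (2 + 1 : ℕ) :=
      Set.encard_eq_three.2 ⟨a, b, c, hab, hac, hbc, rfl⟩
    have hindep : PointsIndep ρ {a, b, c} := by
      rw [pointsIndep_iff_of_encard_eq hthree, ← PlanarSpace.inProjLine_image_iff,
        inProjLine_image_iff_subset_traceOf]
      rintro ⟨W, hW, hsub⟩
      simp only [Set.insert_subset_iff, Set.singleton_subset_iff] at hsub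
      exact hline ⟨_, ⟨⟨W, hW, rfl⟩, a, hsub.1, b, hsub.2.1, hab⟩, hsub⟩
    have hrank : Module.finrank K (pointSpan ρ {a, b, c}) = 3 := by
      exact_mod_cast hindep.encard_eq_finrank.symm.trans hthree
    have hmem : ∀ x ∈ ({a, b, c} : Set P), x ∈ traceOf ρ (pointSpan ρ {a, b, c}) :=
      fun x hx => rep_mem_pointSpan ρ hx
    refine ⟨_, ⟨⟨_, hrank, rfl⟩, hmem a (by simp), hmem b (by simp), hmem c (by simp)⟩, ?_⟩
    rintro _ ⟨⟨W, hW, rfl⟩, haW, hbW, hcW⟩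
    rw [hindep.pointSpan_eq (by rw [hthree, hW])
      (by simp [Set.insert_subset_iff, haW, hbW, hcW])]

/-- The strong realization of `traceSpace ρ hρ` by `ρ` itself. -/
def traceSpaceRealization (ρ : P → ProjSpace3 K) (hρ : Function.Injective ρ) :
    (traceSpace ρ hρ).StrongRealization K where
  toFun := ρ
  injective := hρ
  line_iff S := by
    constructor
    · intro h
      obtain ⟨W, hW, hSW⟩ := inProjLine_image_iff_subset_traceOf.1 h
      exact S.subsingleton_or_nontrivial.imp_right fun hS =>
        ⟨_, ⟨⟨W, hW, rfl⟩, hS.mono hSW⟩, hSW⟩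
    · rintro (hS | ⟨_, ⟨⟨W, hW, rfl⟩, -⟩, hSW⟩)
      · exact inProjLine_image_of_subsingleton hS
      · exact inProjLine_image_iff_subset_traceOf.2 ⟨W, hW, hSW⟩
  plane_iff S := by
    constructor
    · intro h
      obtain ⟨W, hW, hSW⟩ := inProjPlane_image_iff_subset_traceOf.1 h
      exact .inr ⟨_, ⟨W, hW, rfl⟩, hSW⟩
    · rintro ((hS | ⟨_, ⟨⟨W, hW, rfl⟩, -⟩, hSW⟩) | ⟨_, ⟨W, hW, rfl⟩, hSW⟩)
      · exact (inProjLine_image_of_subsingleton hS).inProjPlane_image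
      · exact (inProjLine_image_iff_subset_traceOf.2 ⟨W, hW, hSW⟩).inProjPlane_image
      · exact inProjPlane_image_iff_subset_traceOf.2 ⟨W, hW, hSW⟩

end TraceSpace

section Constraints

variable {α : Type u} {P : Type*} {K : Type v} [Field K] {E : Type w} [AddCommGroup E]
  [Module K E]

/-- A set has at most two minimal members, and these lie below all of its members. -/
def HasCoinitialPair {β : Type*} [LE β] (X : Set β) : Prop :=
  X = ∅ ∨ ∃ a ∈ X, ∃ b ∈ X, ∀ x ∈ X, a ≤ x ∨ b ≤ x

/-- The conditions on the position of the point `p` relative to the points with labels in `V`: the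
subspaces which contain `p` and are spanned by points with labels in `V`. -/
def constraints (σ : α → ℙ K E) (V : Set α) (p : α) : Set (Submodule K E) :=
  {U | (∃ S ⊆ V, pointSpan σ S = U) ∧ (σ p).rep ∈ U}

theorem constraints_image {σ : α → ℙ K E} (φ : P → α) (V : Set P) (p : P) :
    constraints σ (φ '' V) (φ p) = constraints (σ ∘ φ) V p := by
  simp only [constraints, Set.exists_subset_image_iff, pointSpan_image, Function.comp_apply]

variable {ρ : P → ℙ K E} {p : P} {L H U W : Submodule K E}

theorem exists_pointsIndep_of_mem_constraints {V : Set P} (h : U ∈ constraints ρ V p) :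
    ∃ S ⊆ V, PointsIndep ρ S ∧ pointSpan ρ S = U := by
  obtain ⟨⟨S, hSV, rfl⟩, -⟩ := h
  obtain ⟨I, hIS, hI, hspan⟩ := exists_pointsIndep_subset ρ S
  exact ⟨I, hIS.trans hSV, hI, hspan⟩

theorem sup_mem_constraints {V : Set P} (hU : U ∈ constraints ρ V p)
    (hW : W ∈ constraints ρ V p) : U ⊔ W ∈ constraints ρ V p := by
  obtain ⟨⟨S, hSV, rfl⟩, hp⟩ := hU
  obtain ⟨⟨T, hTV, rfl⟩, -⟩ := hW
  exact ⟨⟨S ∪ T, Set.union_subset hSV hTV, pointSpan_union ρ S T⟩,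
    Submodule.mem_sup_left hp⟩

theorem sup_span_rep_mem_constraints {V : Set P} (hU : U ∈ constraints ρ V p) {s : P}
    (hs : s ∈ V) : U ⊔ K ∙ (ρ s).rep ∈ constraints ρ V p := by
  obtain ⟨⟨S, hSV, rfl⟩, hp⟩ := hU
  refine ⟨⟨S ∪ {s}, Set.union_subset hSV (Set.singleton_subset_iff.2 hs), ?_⟩,
    Submodule.mem_sup_left hp⟩
  rw [pointSpan_union, pointSpan, pointSpan, Set.image_singleton]

theorem injOn_traceOf_constraints (ρ : P → ℙ K E) (V : Set P) (p : P) :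
    Set.InjOn (traceOf ρ) (constraints ρ V p) := by
  have hle : ∀ U ∈ constraints ρ V p, ∀ W, traceOf ρ U = traceOf ρ W → U ≤ W := by
    rintro _ ⟨⟨S, -, rfl⟩, -⟩ W h
    rw [← subset_traceOf_iff, ← h, subset_traceOf_iff]
  exact fun U hU W hW h => (hle U hU W h).antisymm (hle W hW U h.symm)

theorem finite_constraints [Finite P] (ρ : P → ℙ K E) (V : Set P) (p : P) :
    (constraints ρ V p).Finite :=
  (Set.finite_range (pointSpan ρ)).subset fun _ ⟨⟨S, _, h⟩, _⟩ => ⟨S, h⟩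

/-- The constraints which all the other points impose on `p` and which are subspaces of dimension
`k`; for `k = 2` and `k = 3` these are lines and planes through `p`. -/
def constraintsOfRank (ρ : P → ℙ K E) (p : P) (k : ℕ) : Set (Submodule K E) :=
  {U ∈ constraints ρ {p}ᶜ p | Module.finrank K U = k}

theorem finite_constraintsOfRank [Finite P] (ρ : P → ℙ K E) (p : P) (k : ℕ) :
    (constraintsOfRank ρ p k).Finite :=
  (finite_constraints ρ {p}ᶜ p).subset fun _ h => h.1

variable [FiniteDimensional K E]

theorem two_le_finrank_of_mem_constraints (hρ : Function.Injective ρ)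
    (hU : U ∈ constraints ρ {p}ᶜ p) : 2 ≤ Module.finrank K U := by
  obtain ⟨S, hpS, hS, rfl⟩ := exists_pointsIndep_of_mem_constraints hU
  have hp : p ∉ S := Set.subset_compl_singleton_iff.1 hpS
  by_contra! hlt
  have hcard : (insert p S).encard ≤ 2 := by
    rw [Set.encard_insert_of_notMem hp, hS.encard_eq_finrank]
    exact_mod_cast hlt
  exact ((pointsIndep_insert hp).1 (pointsIndep_of_encard_le_two hρ hcard)).2 hU.2

theorem le_of_finrank_eq_two (hρ : Function.Injective ρ) (hL : Module.finrank K L = 2) {s : P}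
    (hsp : s ≠ p) (hpL : (ρ p).rep ∈ L) (hsL : (ρ s).rep ∈ L) (hpW : (ρ p).rep ∈ W)
    (hsW : (ρ s).rep ∈ W) : L ≤ W := by
  have hindep : PointsIndep ρ {s, p} := (pointsIndep_pair_iff hsp).2 (hρ.ne hsp)
  rw [← hindep.pointSpan_eq (by rw [Set.encard_pair hsp, hL]; rfl) (Set.pair_subset hsL hpL),
    ← subset_traceOf_iff]
  exact Set.pair_subset hsW hpW

theorem eq_of_le_of_mem_constraintsOfRank {k : ℕ} (hU : U ∈ constraintsOfRank ρ p k)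
    (hW : W ∈ constraintsOfRank ρ p k) (h : U ≤ W) : U = W :=
  Submodule.eq_of_le_of_finrank_eq h (hU.2.trans hW.2.symm)

/-- Otherwise all the points which span `H` lie in `W`, so that `H = W` contains `L`. -/
theorem exists_plane_through_line_ne (hρ : Function.Injective ρ)
    (hL : L ∈ constraintsOfRank ρ p 2) (hH : H ∈ constraintsOfRank ρ p 3) (hLH : ¬L ≤ H)
    (hW : Module.finrank K W = 3) : ∃ U ∈ constraintsOfRank ρ p 3, L ≤ U ∧ U ≠ W := by
  obtain ⟨⟨⟨S, hpS, rfl⟩, hpH⟩, hH3⟩ := hH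
  have hnotMem : ∀ s ∈ S, (ρ s).rep ∉ L := fun s hs hsL => hLH
    (le_of_finrank_eq_two hρ hL.2 (hpS hs) hL.1.2 hsL hpH (rep_mem_pointSpan ρ hs))
  by_contra! hunique
  have hsup : ∀ s ∈ S, L ⊔ K ∙ (ρ s).rep = W := fun s hs =>
    hunique _ ⟨sup_span_rep_mem_constraints hL.1 (hpS hs),
      by rw [Submodule.finrank_sup_span_singleton (hnotMem s hs), hL.2]⟩ le_sup_left
  have hHW : pointSpan ρ S = W := by
    refine Submodule.eq_of_le_of_finrank_eq (pointSpan_le_iff.2 fun s hs => ?_) (by rw [hH3, hW])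
    rw [← hsup s hs]
    exact Submodule.mem_sup_right (Submodule.mem_span_singleton_self _)
  obtain ⟨s, hs⟩ : S.Nonempty := by
    rw [Set.nonempty_iff_ne_empty]
    rintro rfl
    rw [pointSpan, Set.image_empty, Submodule.span_empty, finrank_bot] at hH3
    omega
  exact hLH (hHW ▸ hsup s hs ▸ le_sup_left)

theorem four_le_ncard {T : Type*} {X : Set T} (hX : X.Finite) {a b c d : T} (ha : a ∈ X)
    (hb : b ∈ X) (hc : c ∈ X) (hd : d ∈ X) (hab : a ≠ b) (hac : a ≠ c) (had : a ≠ d)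
    (hbc : b ≠ c) (hbd : b ≠ d) (hcd : c ≠ d) : 4 ≤ X.ncard := by
  have hcard : ({a, b, c, d} : Set T).ncard = 4 := by
    rw [Set.ncard_insert_of_notMem (by simp [hab, hac, had]),
      Set.ncard_eq_three.2 ⟨b, c, d, hbc, hbd, hcd, rfl⟩]
  rw [← hcard]
  exact Set.ncard_le_ncard (by simp [Set.insert_subset_iff, ha, hb, hc, hd]) hX

theorem exists_subset_pair_of_ncard_le_two {T : Type*} {X : Set T} (hne : X.Nonempty)
    (hX : X.Finite) (h : X.ncard ≤ 2) : ∃ a ∈ X, ∃ b ∈ X, X ⊆ {a, b} := by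
  have hpos := (Set.ncard_pos hX).2 hne
  obtain h1 | h2 : X.ncard = 1 ∨ X.ncard = 2 := by omega
  · obtain ⟨a, rfl⟩ := Set.ncard_eq_one.1 h1
    exact ⟨a, rfl, a, rfl, by simp⟩
  · obtain ⟨a, b, -, rfl⟩ := Set.ncard_eq_two.1 h2
    exact ⟨a, by simp, b, by simp, subset_rfl⟩

theorem sup_mem_constraintsOfRank_three {L' : Submodule K E}
    (hL : L ∈ constraintsOfRank ρ p 2) (hL' : L' ∈ constraintsOfRank ρ p 2) (hne : L ≠ L') :
    L ⊔ L' ∈ constraintsOfRank ρ p 3 := by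
  refine ⟨sup_mem_constraints hL.1 hL'.1, ?_⟩
  have hsum := Submodule.finrank_sup_add_finrank_inf_eq L L'
  have hinf : Module.finrank K ↥(L ⊓ L') < 2 := by
    by_contra! hle
    have hLL' : L ≤ L' := by
      rw [← inf_eq_left]
      exact Submodule.eq_of_le_of_finrank_le inf_le_left (hL.2.trans_le hle)
    exact hne (eq_of_le_of_mem_constraintsOfRank hL hL' hLL')
  have hpos : 0 < Module.finrank K ↥(L ⊓ L') :=
    Module.finrank_pos_iff_exists_ne_zero.2
      ⟨⟨_, hL.1.2, hL'.1.2⟩, fun h => (ρ p).rep_nonzero (congrArg Subtype.val h)⟩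
  rw [hL.2, hL'.2] at hsum
  omega

variable [Finite P]

theorem four_le_ncard_planes_of_line (hρ : Function.Injective ρ)
    (hL : L ∈ constraintsOfRank ρ p 2) (hH : H ∈ constraintsOfRank ρ p 3)
    (hW : W ∈ constraintsOfRank ρ p 3) (hHW : H ≠ W) (hLH : ¬L ≤ H) (hLW : ¬L ≤ W) :
    4 ≤ (constraintsOfRank ρ p 3).ncard := by
  obtain ⟨U, hU, hLU, -⟩ := exists_plane_through_line_ne hρ hL hH hLH hH.2
  obtain ⟨V, hV, hLV, hVU⟩ := exists_plane_through_line_ne hρ hL hH hLH hU.2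
  exact four_le_ncard (finite_constraintsOfRank ρ p 3) hH hW hU hV hHW
    (fun h => hLH (h ▸ hLU)) (fun h => hLH (h ▸ hLV)) (fun h => hLW (h ▸ hLU))
    (fun h => hLW (h ▸ hLV)) hVU.symm

theorem four_le_ncard_planes_of_lines {L' : Submodule K E} (hρ : Function.Injective ρ)
    (hL : L ∈ constraintsOfRank ρ p 2) (hL' : L' ∈ constraintsOfRank ρ p 2) (hne : L ≠ L')
    (hH : H ∈ constraintsOfRank ρ p 3) (hLH : ¬L ≤ H) (hLH' : ¬L' ≤ H) :
    4 ≤ (constraintsOfRank ρ p 3).ncard := by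
  have hW := sup_mem_constraintsOfRank_three hL hL' hne
  obtain ⟨U, hU, hLU, hUW⟩ := exists_plane_through_line_ne hρ hL hH hLH hW.2
  obtain ⟨V, hV, hLV, hVW⟩ := exists_plane_through_line_ne hρ hL' hH hLH' hW.2
  have hUV : U ≠ V := fun h => hUW
    (eq_of_le_of_mem_constraintsOfRank hW hU (sup_le hLU (h ▸ hLV))).symm
  exact four_le_ncard (finite_constraintsOfRank ρ p 3) hH hW hU hV
    (fun h => hLH (h ▸ le_sup_left)) (fun h => hLH (h ▸ hLU)) (fun h => hLH' (h ▸ hLV))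
    hUW.symm hVW.symm hUV

end Constraints

section ThreeSpace

variable {P : Type u} {K : Type v} [Field K] {ρ : P → ProjSpace3 K} {p : P}

theorem hasCoinitialPair_constraints_of_forall_rank (hρ : Function.Injective ρ)
    {F G : Submodule K (Fin 4 → K)} (hF : F ∈ constraints ρ {p}ᶜ p)
    (hG : G ∈ constraints ρ {p}ᶜ p) (hlines : ∀ U ∈ constraintsOfRank ρ p 2, F ≤ U ∨ G ≤ U)
    (hplanes : ∀ U ∈ constraintsOfRank ρ p 3, F ≤ U ∨ G ≤ U) :
    HasCoinitialPair (constraints ρ {p}ᶜ p) := by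
  refine .inr ⟨F, hF, G, hG, fun U hU => ?_⟩
  have hge := two_le_finrank_of_mem_constraints hρ hU
  have hle : Module.finrank K U ≤ 4 := by simpa using U.finrank_le
  obtain h2 | h3 | h4 : Module.finrank K U = 2 ∨ Module.finrank K U = 3 ∨
    Module.finrank K U = 4 := by omega
  · exact hlines U ⟨hU, h2⟩
  · exact hplanes U ⟨hU, h3⟩
  · exact .inl (le_top.trans (Submodule.eq_top_of_finrank_eq (by simpa using h4)).ge)

theorem nonempty_constraintsOfRank_two (hρ : Function.Injective ρ)
    (h : (traceSpace ρ hρ).lineIndex p ≠ 0) : (constraintsOfRank ρ p 2).Nonempty := by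
  obtain ⟨_, ⟨⟨⟨W, hW, rfl⟩, -⟩, hthree⟩, hp⟩ := Set.nonempty_of_ncard_ne_zero h
  have htwo : 1 < (traceOf ρ W \ {p}).encard := by
    by_contra! hle
    rw [← Set.encard_sdiff_singleton_add_one hp] at hthree
    exact absurd (hthree.trans (add_le_add_left hle 1)) (by decide)
  obtain ⟨a, b, ha, hb, hab⟩ := Set.one_lt_encard_iff.1 htwo
  have hindep : PointsIndep ρ {a, b} := (pointsIndep_pair_iff hab).2 (hρ.ne hab)
  have hspan := hindep.pointSpan_eq (by rw [Set.encard_pair hab, hW]; rfl)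
    (Set.pair_subset ha.1 hb.1)
  exact ⟨W, ⟨⟨_, Set.pair_subset ha.2 hb.2, hspan⟩, hp⟩, hW⟩

variable [Finite P]

theorem hasCoinitialPair_constraints_of_no_lines (hρ : Function.Injective ρ)
    (hlines : constraintsOfRank ρ p 2 = ∅) (hplanes : (constraintsOfRank ρ p 3).ncard ≤ 2) :
    HasCoinitialPair (constraints ρ {p}ᶜ p) := by
  obtain hX | ⟨U, hU⟩ := (constraints ρ {p}ᶜ p).eq_empty_or_nonempty
  · exact .inl hX
  obtain hempty | hne := (constraintsOfRank ρ p 3).eq_empty_or_nonempty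
  · exact hasCoinitialPair_constraints_of_forall_rank hρ hU hU (by simp [hlines])
      (by simp [hempty])
  · obtain ⟨F, hF, G, hG, hFG⟩ :=
      exists_subset_pair_of_ncard_le_two hne (finite_constraintsOfRank ρ p 3) hplanes
    exact hasCoinitialPair_constraints_of_forall_rank hρ hF.1 hG.1 (by simp [hlines])
      fun H hH => (hFG hH).imp (fun h => h.ge) fun h => h.ge

theorem hasCoinitialPair_constraints_of_lines (hρ : Function.Injective ρ)
    (hne : (constraintsOfRank ρ p 2).Nonempty) (hlines : (constraintsOfRank ρ p 2).ncard ≤ 2)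
    (hplanes : (constraintsOfRank ρ p 3).ncard < 4) :
    HasCoinitialPair (constraints ρ {p}ᶜ p) := by
  obtain ⟨L, hL, L', hL', hLL'⟩ :=
    exists_subset_pair_of_ncard_le_two hne (finite_constraintsOfRank ρ p 2) hlines
  by_cases hall : ∀ H ∈ constraintsOfRank ρ p 3, L ≤ H ∨ L' ≤ H
  · exact hasCoinitialPair_constraints_of_forall_rank hρ hL.1 hL'.1
      (fun U hU => (hLL' hU).imp (fun h => h.ge) fun h => h.ge) hall
  push Not at hall
  obtain ⟨H, hH, hLH, hL'H⟩ := hall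
  obtain rfl : L = L' := by
    by_contra hne
    exact hplanes.not_ge (four_le_ncard_planes_of_lines hρ hL hL' hne hH hLH hL'H)
  refine hasCoinitialPair_constraints_of_forall_rank hρ hL.1 hH.1
    (fun U hU => .inl ((hLL' hU).elim (fun h => h.ge) fun h => h.ge)) fun U hU => ?_
  by_contra! hnot
  exact hplanes.not_ge
    (four_le_ncard_planes_of_line hρ hL hH hU (fun h => hnot.2 h.le) hLH hnot.1)

theorem ncard_constraintsOfRank_three_le (hρ : Function.Injective ρ) :
    (constraintsOfRank ρ p 3).ncard ≤ (traceSpace ρ hρ).planeIndex p := by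
  refine Set.ncard_le_ncard_of_injOn (traceOf ρ) ?_
    ((injOn_traceOf_constraints ρ {p}ᶜ p).mono fun _ h => h.1) (Set.toFinite _)
  rintro U ⟨hU, hU3⟩
  obtain ⟨S, hpS, hS, rfl⟩ := exists_pointsIndep_of_mem_constraints hU
  have hsub : S ⊆ traceOf ρ (pointSpan ρ S) := subset_traceOf_iff.2 le_rfl
  refine ⟨⟨⟨_, hU3, rfl⟩, ?_, fun h => ?_⟩, hU.2⟩
  · refine le_trans ?_ (Set.encard_le_encard (Set.insert_subset hU.2 hsub))
    rw [Set.encard_insert_of_notMem (Set.subset_compl_singleton_iff.1 hpS),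
      hS.encard_eq_finrank, hU3]
    decide
  · have hle := PlanarSpace.inProjLine_image_iff.1
      (((traceSpaceRealization ρ hρ).line_iff S).2 (h.mono hsub))
    exact absurd (hU3.symm.trans_le hle) (by decide)

theorem ncard_constraintsOfRank_two_le (hρ : Function.Injective ρ) :
    (constraintsOfRank ρ p 2).ncard ≤ (traceSpace ρ hρ).lineIndex p := by
  refine Set.ncard_le_ncard_of_injOn (traceOf ρ) ?_
    ((injOn_traceOf_constraints ρ {p}ᶜ p).mono fun _ h => h.1) (Set.toFinite _)
  rintro U ⟨hU, hU2⟩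
  obtain ⟨S, hpS, hS, rfl⟩ := exists_pointsIndep_of_mem_constraints hU
  have hsub : S ⊆ traceOf ρ (pointSpan ρ S) := subset_traceOf_iff.2 le_rfl
  have hS2 : S.encard = 2 := by rw [hS.encard_eq_finrank, hU2]; rfl
  have hnontrivial : S.Nontrivial := Set.one_lt_encard_iff_nontrivial.1 (by rw [hS2]; decide)
  refine ⟨⟨⟨⟨_, hU2, rfl⟩, hnontrivial.mono hsub⟩, ?_⟩, hU.2⟩
  refine le_trans ?_ (Set.encard_le_encard (Set.insert_subset hU.2 hsub))
  rw [Set.encard_insert_of_notMem (Set.subset_compl_singleton_iff.1 hpS), hS2]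
  decide

/-- Three minimal constraints occur only if there are three lines, or three planes and no line, or
if two of them, one a line, force four planes to pass through `p`. -/
theorem hasCoinitialPair_constraints_of_index (hρ : Function.Injective ρ)
    (h : ¬(4 ≤ (traceSpace ρ hρ).planeIndex p ∨ 3 ≤ (traceSpace ρ hρ).lineIndex p ∨
      ((traceSpace ρ hρ).planeIndex p = 3 ∧ (traceSpace ρ hρ).lineIndex p = 0))) :
    HasCoinitialPair (constraints ρ {p}ᶜ p) := by
  have hplanes := ncard_constraintsOfRank_three_le (p := p) hρ
  have hlines := ncard_constraintsOfRank_two_le (p := p) hρ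
  obtain hempty | hne := (constraintsOfRank ρ p 2).eq_empty_or_nonempty
  · have hzero : (traceSpace ρ hρ).lineIndex p = 0 := by
      by_contra hne
      exact (nonempty_constraintsOfRank_two hρ hne).ne_empty hempty
    exact hasCoinitialPair_constraints_of_no_lines hρ hempty (by omega)
  · exact hasCoinitialPair_constraints_of_lines hρ hne (by omega) (by omega)

end ThreeSpace

section Terminal

variable {α : Type u} {K : Type v} [Field K]

theorem ConfigType.isLabelling_traceSpace {P : Type w} {b : ProjSpace3 K} {C : ConfigType α}
    {σ : α → ProjSpace3 K} (hσ : σ ∈ realizations b C) {φ : P → α} (hφ : Function.Injective φ)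
    (hrange : (C.points : Set α) = Set.range φ) (hinj : Function.Injective (σ ∘ φ)) :
    C.IsLabelling (traceSpace (σ ∘ φ) hinj) φ where
  injective := hφ
  coe_points := hrange
  mem_indep_iff A := by
    rw [(_root_.mem_realizations_iff.1 hσ).2, ← Finset.coe_subset, hrange,
      Set.subset_range_iff_exists_image_eq]
    simp only [(traceSpaceRealization (σ ∘ φ) hinj).indep_iff]
    constructor
    · rintro ⟨⟨S, hS⟩, hA⟩
      exact ⟨S, (pointsIndep_image hφ S).1 (hS ▸ hA), hS⟩
    · rintro ⟨S, hindep, hS⟩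
      exact ⟨⟨S, hS⟩, hS ▸ (pointsIndep_image hφ S).2 hindep⟩

section Freedom

variable [DecidableEq α] {E : Type w} [AddCommGroup E] [Module K E] {b : ℙ K E} {C : ConfigType α}
  {σ : α → ℙ K E} {p : α}

theorem exists_mem_avoiding_pointSpan_eq (hσ : σ ∈ realizations b C) {A : Set α}
    (hA : A ⊆ C.points \ {p}) :
    ∃ F ∈ C.avoiding p, (F : Set α) ⊆ A ∧ pointSpan σ (F : Set α) = pointSpan σ A := by
  obtain ⟨I, hIA, hI, hspan⟩ := exists_pointsIndep_subset σ A
  have hIC := hIA.trans hA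
  lift I to Finset α using C.points.finite_toSet.subset fun x hx => (hIC hx).1
  refine ⟨I, ConfigType.mem_avoiding.2 ⟨?_, fun hp => (hIC hp).2 rfl⟩, hIA, hspan⟩
  exact ((mem_realizations_iff.1 hσ).2 I).2 ⟨fun x hx => (hIC hx).1, hI⟩

theorem exists_hasFreedom_of_hasCoinitialPair (n : ℕ) (hσ : σ ∈ realizations b C)
    (hp : p ∈ C.points) (h : HasCoinitialPair (constraints σ (C.points \ {p}) p)) :
    ∃ d, C.HasFreedom n p d := by
  have hspans {S : Finset α} (hS : S ∈ C.avoiding p) {y : α} (hy : y ∈ C.points) :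
      C.Spans S y ↔ (σ y).rep ∈ pointSpan σ (S : Set α) :=
    spans_iff_of_mem_realizations hσ (ConfigType.mem_avoiding.1 hS).1 hy
  have hsub {S : Finset α} (hS : S ∈ C.avoiding p) : (S : Set α) ⊆ C.points \ {p} := fun x hx =>
    ⟨(((mem_realizations_iff.1 hσ).2 S).1 (ConfigType.mem_avoiding.1 hS).1).1 hx,
      ne_of_mem_of_not_mem hx (ConfigType.mem_avoiding.1 hS).2⟩
  have hconstraint {S : Finset α} (hS : S ∈ C.avoiding p) (hSp : C.Spans S p) :
      pointSpan σ (S : Set α) ∈ constraints σ (C.points \ {p}) p :=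
    ⟨⟨S, hsub hS, rfl⟩, (hspans hS hp).1 hSp⟩
  have hle {S T : Finset α} (hS : S ∈ C.avoiding p) (hT : T ∈ C.avoiding p)
      (h : pointSpan σ (T : Set α) ≤ pointSpan σ (S : Set α)) : ∀ y ∈ T, C.Spans S y :=
    fun y hy => (hspans hS (hsub hT hy).1).2 (h (rep_mem_pointSpan σ hy))
  obtain hempty | ⟨_, ⟨⟨A, hA, rfl⟩, hpA⟩, _, ⟨⟨A', hA', rfl⟩, hpA'⟩, hmin⟩ := h
  · exact ⟨n, .inl ⟨fun S hS hSp => (hempty ▸ hconstraint hS hSp).elim, rfl⟩⟩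
  obtain ⟨F, hF, -, hFA⟩ := exists_mem_avoiding_pointSpan_eq hσ hA
  obtain ⟨G, hG, -, hGA⟩ := exists_mem_avoiding_pointSpan_eq hσ hA'
  obtain ⟨B, hB, hBFG, hBspan⟩ :=
    exists_mem_avoiding_pointSpan_eq hσ (Set.union_subset (hsub hF) (hsub hG))
  refine ⟨_, .inr ⟨F, hF, G, hG, B, hB, ⟨⟨?_, ?_⟩, ⟨by exact_mod_cast hBFG, fun y hy => ?_⟩,
    fun S hS hSp => ?_⟩, rfl⟩⟩
  · exact (hspans hF hp).2 (hFA ▸ hpA)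
  · exact (hspans hG hp).2 (hGA ▸ hpA')
  · obtain hyF | hyG := Finset.mem_union.1 hy
    · exact hle hB hF (hBspan ▸ pointSpan_mono σ Set.subset_union_left) y hyF
    · exact hle hB hG (hBspan ▸ pointSpan_mono σ Set.subset_union_right) y hyG
  · exact (hmin _ (hconstraint hS hSp)).imp (fun h => hle hS hF (hFA ▸ h))
      fun h => hle hS hG (hGA ▸ h)

theorem injOn_of_forall_not_hasFreedom {n : ℕ} (hσ : σ ∈ realizations b C)
    (h : ∀ p ∈ C.points, ∀ d, ¬C.HasFreedom n p d) : Set.InjOn σ C.points := by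
  intro x hx y hy hxy
  by_contra hne
  have hmem : pointSpan σ {y} ∈ constraints σ (C.points \ {x}) x :=
    ⟨⟨{y}, Set.singleton_subset_iff.2 ⟨hy, Ne.symm hne⟩, rfl⟩,
      hxy ▸ rep_mem_pointSpan σ (Set.mem_singleton y)⟩
  obtain ⟨d, hd⟩ := exists_hasFreedom_of_hasCoinitialPair n hσ hx
    (.inr ⟨_, hmem, _, hmem, fun U hU => .inl (pointSpan_le_iff.2 fun _ hz => hz ▸ hxy ▸ hU.2)⟩)
  exact h x hx d hd

theorem ncard_realizations_of_points_eq_empty (h : C.points = ∅) :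
    (realizations b C).ncard = if C.indep = {∅} then 1 else 0 := by
  have hmem : ∀ σ : α → ℙ K E, σ ∈ realizations b C ↔ σ = (fun _ => b) ∧ C.indep = {∅} := by
    intro σ
    rw [mem_realizations_iff, h, funext_iff, Finset.ext_iff (s₁ := C.indep)]
    simp only [Finset.notMem_empty, not_false_eq_true, true_implies, Finset.subset_empty,
      Finset.mem_singleton]
    refine and_congr_right fun _ => forall_congr' fun S => iff_congr Iff.rfl ?_
    refine and_iff_left_of_imp ?_
    rintro rfl
    simpa using pointsIndep_empty σ
  split_ifs with hindep
  · rw [Set.ncard_eq_one]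
    exact ⟨fun _ => b, Set.ext fun σ => by simp [hmem, hindep]⟩
  · rw [Set.eq_empty_of_forall_notMem fun σ hσ => hindep ((hmem σ).1 hσ).2, Set.ncard_empty]

end Freedom

theorem exists_hyperfiguration_models [DecidableEq α] {b : ProjSpace3 K} {C : ConfigType α}
    {σ : α → ProjSpace3 K} (hσ : σ ∈ realizations b C) (hne : C.points.Nonempty)
    (h : ∀ p ∈ C.points, ∀ d, ¬C.HasFreedom 4 p d) {n : ℕ} (hn : C.points.card ≤ n) :
    ∃ k : Hyperfiguration n, C.Models k.space := by
  let φ : Fin C.points.card → α := Subtype.val ∘ C.points.equivFin.symm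
  have hφ : Function.Injective φ := Subtype.val_injective.comp (Equiv.injective _)
  have hrange : (C.points : Set α) = Set.range φ := by
    rw [Set.range_comp, Equiv.range_eq_univ, Set.image_univ, Subtype.range_coe]
  have hinj : Function.Injective (σ ∘ φ) :=
    ((injOn_of_forall_not_hasFreedom hσ h).injective_iff _ hrange.ge).2 hφ
  have hpair (i : Fin C.points.card) : ¬HasCoinitialPair (constraints (σ ∘ φ) {i}ᶜ i) := by
    rw [← constraints_image, Set.image_compl_eq_range_sdiff_image hφ, Set.image_singleton, ← hrange]
    intro hi
    obtain ⟨d, hd⟩ := exists_hasFreedom_of_hasCoinitialPair 4 hσ (C.points.equivFin.symm i).2 hi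
    exact h _ (C.points.equivFin.symm i).2 d hd
  refine ⟨⟨⟨C.points.card, Nat.lt_succ_of_le hn⟩, traceSpace (σ ∘ φ) hinj,
    ⟨⟨0, hne.card_pos⟩⟩, fun i => ?_⟩, φ, ConfigType.isLabelling_traceSpace hσ hφ hrange hinj⟩
  exact not_not.1 (mt (hasCoinitialPair_constraints_of_index hinj) (hpair i))

end Terminal

section Classes

variable {α : Type u} {C : ConfigType α} {n : ℕ}

theorem HyperfigurationClass.numRealizations_out (h : HyperfigurationClass n) (K : Type v)
    [Field K] : h.out.space.numRealizations K = h.numRealizations K := by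
  conv_rhs => rw [← Quotient.out_eq h]
  rfl

theorem ConfigType.models_out_mk_iff (h : Hyperfiguration n) :
    C.Models (Quotient.mk _ h : HyperfigurationClass n).out.space ↔ C.Models h.space :=
  have hiso : (Quotient.mk _ h : HyperfigurationClass n).out.space.Iso h.space :=
    Quotient.mk_out (s := Hyperfiguration.isoSetoid n) h
  ⟨fun hC => hC.of_iso hiso, fun hC => hC.of_iso hiso.symm⟩

open Classical in
theorem sum_ite_models_eq_ncard_realizations [DecidableEq α] {K : Type v} [Field K]
    (b : ProjSpace3 K) (hne : C.points.Nonempty)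
    (hC : ∀ p ∈ C.points, ∀ d, ¬C.HasFreedom 4 p d) (hn : C.points.card ≤ n) :
    (∑ h : HyperfigurationClass n, if C.Models h.out.space then h.numRealizations K else 0) =
      (realizations b C).ncard := by
  have hterm (h : HyperfigurationClass n) :
      (if C.Models h.out.space then h.numRealizations K else 0) =
        if C.Models h.out.space then (realizations b C).ncard else 0 :=
    if_ctx_congr Iff.rfl
      (fun hh => by rw [hh.ncard_realizations b, h.numRealizations_out]) fun _ => rfl
  rw [Finset.sum_congr rfl fun h _ => hterm h]
  obtain hempty | ⟨σ, hσ⟩ := (realizations b C).eq_empty_or_nonempty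
  · simp [hempty]
  · obtain ⟨k, hk⟩ := exists_hyperfiguration_models hσ hne hC hn
    have hunique (h : HyperfigurationClass n) : C.Models h.out.space ↔ Quotient.mk _ k = h := by
      refine ⟨fun hh => ?_, fun hh => hh ▸ (ConfigType.models_out_mk_iff k).2 hk⟩
      rw [← Quotient.out_eq h]
      exact Quotient.sound (hk.iso hh)
    simp only [hunique, Finset.sum_ite_eq, Finset.mem_univ, if_true]

end Classes

section Expansion

variable {K : Type v} [Field K] {n : ℕ}

open Classical in
theorem ConfigTerm.value_eq_ite_add_sum_ite (b : ProjSpace3 K) {t : ConfigTerm}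
    (ht : t.2.2.WellFormed) (hchoices : t.2.2.choices 4 = []) (hn : t.2.2.1.length ≤ n) :
    t.value b =
      (if t.2.2.1 = [] ∧ family t.2.2.2 = {∅} then t.monomial.eval (Nat.card K : ℤ) else 0) +
        ∑ h : HyperfigurationClass n,
          (if ¬t.2.2.1 = [] ∧ t.2.2.toType.Models h.out.space
            then t.monomial.eval (Nat.card K : ℤ) else 0) * (h.numRealizations K : ℤ) := by
  by_cases hnil : t.2.2.1 = []
  · have hpoints : t.2.2.toType.points = ∅ := by rw [ConfigCode.toType, hnil, List.toFinset_nil]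
    rw [value, ncard_realizations_of_points_eq_empty hpoints]
    simp [hnil, ConfigCode.toType]
  · have hfree (p) (hp : p ∈ t.2.2.toType.points) (d) : ¬t.2.2.toType.HasFreedom 4 p d := fun hd =>
      List.not_mem_nil (hchoices ▸ (ConfigCode.mem_choices ht).2 ⟨hp, hd⟩)
    have hcard : t.2.2.toType.points.card ≤ n :=
      (List.toFinset_card_of_nodup ht.nodup_points).trans_le hn
    rw [value, ← sum_ite_models_eq_ncard_realizations b (List.toFinset_nonempty_iff _ |>.2 hnil)
      hfree hcard, Nat.cast_sum, Finset.mul_sum]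
    simp [hnil]

open Classical in
theorem ConfigTerm.sum_map_value_eq_eval_add_sum_eval_mul (b : ProjSpace3 K) {ts : List ConfigTerm}
    (hts : ∀ t ∈ ts, t.2.2.WellFormed ∧ t.2.2.choices 4 = [] ∧ t.2.2.1.length ≤ n) :
    (ts.map (value b)).sum =
      ((ts.filter fun t => t.2.2.1 = [] ∧ family t.2.2.2 = {∅}).map monomial).sum.eval
        (Nat.card K : ℤ) +
      ∑ h : HyperfigurationClass n,
        ((ts.filter fun t => ¬t.2.2.1 = [] ∧ t.2.2.toType.Models h.out.space).map
          monomial).sum.eval (Nat.card K : ℤ) * (h.numRealizations K : ℤ) := by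
  induction ts with
  | nil => simp
  | cons t ts ih =>
    obtain ⟨⟨hwf, hchoices, hn⟩, hts⟩ := List.forall_mem_cons.1 hts
    have hcons (p : ConfigTerm → Prop) [DecidablePred p] :
        (((t :: ts).filter p).map monomial).sum.eval (Nat.card K : ℤ) =
          (if p t then t.monomial.eval (Nat.card K : ℤ) else 0) +
            ((ts.filter p).map monomial).sum.eval (Nat.card K : ℤ) := by
      by_cases hp : p t <;> simp [hp]
    rw [List.map_cons, List.sum_cons, ih hts, value_eq_ite_add_sum_ite b hwf hchoices hn]
    simp only [hcons, add_mul, Finset.sum_add_distrib]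
    ring

end Expansion

open Classical in
theorem polyOfCoeffs_hyperPart (c : PlanarCode) {n : ℕ} (h : Hyperfiguration n) {d : PlanarCode}
    (hd : d.Describes h.space) :
    polyOfCoeffs (hyperPart c d) = (((c.type.run 4).filter fun t =>
      ¬t.2.2.1 = [] ∧ t.2.2.toType.Models h.space).map ConfigTerm.monomial).sum := by
  rw [hyperPart, ConfigTerm.polyOfCoeffs_coeffs]
  congr 2
  refine List.filter_congr fun t ht => ?_
  have hwf := (c.wellFormed_type.of_mem_iterate_step _ ht).1
  simp only [ConfigCode.matchesCode_iff hwf.nodup_points hd]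

theorem PlanarCode.Describes.sum_value_run {P : Type u} {f : PlanarSpace P} {c : PlanarCode}
    {K : Type v} [Field K] [Finite K] (hc : c.Describes f) (b : ProjSpace3 K) :
    ((c.type.run 4).map (ConfigTerm.value b)).sum = f.numRealizations K := by
  have hsum := ConfigCode.sum_value_run b c.wellFormed_type
  rwa [Module.finrank_fin_fun, hc.models.ncard_realizations] at hsum

theorem mainTheorem6 :
    ∃ (r : PlanarCode → List ℤ) (rh : PlanarCode → PlanarCode → List ℤ),
      Computable r ∧ Computable₂ rh ∧
      ∀ (P : Type u) [Finite P] (f : PlanarSpace P) (c : PlanarCode), c.Describes f →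
        ∃ (R : ℤ[X]) (Rh : HyperfigurationClass (Nat.card P) → ℤ[X]),
          (∀ (K : Type v) [Field K] [Finite K],
            (f.numRealizations K : ℤ) = R.eval (Nat.card K : ℤ) +
              ∑ h : HyperfigurationClass (Nat.card P),
                (Rh h).eval (Nat.card K : ℤ) * (h.numRealizations K : ℤ)) ∧
          polyOfCoeffs (r c) = R ∧
          ∀ (h : Hyperfiguration (Nat.card P)) (d : PlanarCode), d.Describes h.space →
            polyOfCoeffs (rh c d) = Rh (Quotient.mk _ h) := by
  classical
  refine ⟨polyPart, hyperPart, primrec_polyPart.to_comp, primrec_hyperPart.to_comp,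
    fun P _ f c hc => ⟨polyOfCoeffs (polyPart c), fun h => (((c.type.run 4).filter fun t =>
      ¬t.2.2.1 = [] ∧ t.2.2.toType.Models h.out.space).map ConfigTerm.monomial).sum,
      fun K _ _ => ?_, rfl, fun h d hd => ?_⟩⟩
  · have hterminal : ∀ t ∈ c.type.run 4, t.2.2.WellFormed ∧ t.2.2.choices 4 = [] ∧
        t.2.2.1.length ≤ Nat.card P := fun t ht =>
      have ⟨hwf, hlength⟩ := c.wellFormed_type.of_mem_iterate_step _ ht
      ⟨hwf, ConfigCode.choices_eq_nil_of_mem_run ht,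
        hlength.trans_eq (List.length_range.trans hc.natCard_eq.symm)⟩
    rw [polyPart, ConfigTerm.polyOfCoeffs_coeffs,
      ← hc.sum_value_run (Projectivization.mk K 1 one_ne_zero),
      ConfigTerm.sum_map_value_eq_eval_add_sum_eval_mul _ hterminal]
  · rw [polyOfCoeffs_hyperPart c h hd]
    simp only [ConfigType.models_out_mk_iff]
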